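/- Let $\mathbb N=\{0,1,2,\dots\}$, let $r\ge 1$ be an integer and let $M=(M_p)_{p\in\mathbb N}$ be a sequence of positive real numbers with $1=M_0\le M_1$, $M_j^2\le M_{j-1}M_{j+1}$ for all $j\ge 1$, and $\lim_{p\to\infty}(M_p)^{1/p}=\infty$ (that is, $M\in\mathcal{LC}$). Put $\mu_p:=M_p/M_{p-1}$ for $p\ge 1$, and for integers $p,s\ge 1$ $$\lambda_{p,s}:=\sup_{0\le j<p}\left(\frac{M_p}{s^pM_j}\right)^{1/(p-j)}.$$ For $h>0$ let $\Lambda_{M,h}$ be the set of all $(a_p)_p\in\mathbb C^{\mathbb N}$ with $\sup_{p\in\mathbb N}\frac{|a_p|}{h^pM_p}<\infty$, and let $\mathcal D_{r,M,h}([-1,1])$ be the set of all $C^\infty$ functions $f:\mathbb R\to\mathbb C$ with support in $[-1,1]$, with $f^{(rn+j)}(0)=0$ for all $n\in\mathbb N$ and $1\le j\le r-1$, and with $\sup_{n\in\mathbb N,\,x\in\mathbb R}\frac{|f^{(rn)}(x)|}{h^nM_n}<\infty$. Put $$\Lambda_{\{M\}}:=\bigcup_{h>0}\Lambda_{M,h},\quad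 \Lambda_{(M)}:=\bigcap_{h>0}\Lambda_{M,h},\quad \mathcal D_{r,\{M\}}([-1,1]):=\bigcup_{h>0}\mathcal D_{r,M,h}([-1,1]),\quad \mathcal D_{r,(M)}([-1,1]):=\bigcap_{h>0}\mathcal D_{r,M,h}([-1,1]).$$ Theorem. (a) Assume that $\lim_{p\to\infty}\left(\frac{(M_p)^{1/r}}{p!}\right)^{1/p}=\infty$. Then the following are equivalent: (i) the Borel map $\mathcal D_{r,\{M\}}([-1,1])\to\Lambda_{\{M\}}$, $f\mapsto(f^{(rj)}(0))_{j\in\mathbb N}$, is surjective; (ii) the Borel map $\mathcal D_{r,(M)}([-1,1])\to\Lambda_{(M)}$, $f\mapsto(f^{(rj)}(0))_{j\in\mathbb N}$, is surjective; (iii) condition $(M,M)_{SV_r}$: there is an integer $s\ge 1$ with $\displaystyle\sup_{p\ge 1}\frac{(\lambda_{p,s})^{1/r}}{p}\sum_{k\ge p}\left(\frac1{\mu_k}\right)^{1/r}<\infty$; (iv) condition $(\gamma_r)$: $\displaystyle\sup_{p\ge 1}\frac{(\mu_p)^{1/r}}{p}\sum_{k\ge p}\left(\frac1{\mu_k}\right)^{1/r}<\infty$.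 (b) If instead only $\liminf_{p\to\infty}\left(\frac{(M_p)^{1/r}}{p!}\right)^{1/p}>0$ is assumed, then (i), (iii) and (iv) are equivalent. -/

import Mathlib

open Filter Topology
open scoped ContDiff Nat ENNReal

noncomputable section

namespace RamifiedBorel

/-- The quotients `μ_p = M_p / M_{p-1}` for `p ≥ 1`, with `μ_0 = 1`. -/
def quot (M : ℕ → ℝ) (p : ℕ) : ℝ :=
  if p = 0 then 1 else M p / M (p - 1)

/-- The class `LC` of positive, normalized, log-convex sequences with `(M_k)^{1/k} → ∞`. -/
structure IsLC (M : ℕ → ℝ) : Prop where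
  pos : ∀ p, 0 < M p
  zero_eq_one : M 0 = 1
  one_le_one : 1 ≤ M 1
  logConvex : ∀ j, 1 ≤ j → M j ^ 2 ≤ M (j - 1) * M (j + 1)
  root_tendsto : Tendsto (fun k : ℕ => M k ^ (1 / (k : ℝ))) atTop atTop

/-- `((M_p)^{1/r} / p!)^{1/p}`. -/
def rootQuot (r : ℝ) (M : ℕ → ℝ) (p : ℕ) : ℝ :=
  (M p ^ (1 / r) / (p ! : ℝ)) ^ (1 / (p : ℝ))

/-- Condition `(II)_{B,r}`: `lim ((M_p)^{1/r} / p!)^{1/p} = ∞`. -/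
def CondB (r : ℝ) (M : ℕ → ℝ) : Prop :=
  Tendsto (rootQuot r M) atTop atTop

/-- Condition `(II)_{R,r}`: `liminf ((M_p)^{1/r} / p!)^{1/p} > 0`, the lower limit being taken in
`[0, ∞]` because the sequence may be unbounded. -/
def CondR (r : ℝ) (M : ℕ → ℝ) : Prop :=
  0 < liminf (fun p : ℕ => ENNReal.ofReal (rootQuot r M p)) atTop

/-- `λ_{p,s}^{M,N} = sup_{0 ≤ j < p} (M_p / (s^p N_j))^{1/(p-j)}`, for `p, s ≥ 1`. -/
def lam (M N : ℕ → ℝ) (p s : ℕ) : ℝ :=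
  ⨆ j : Fin p, (M p / ((s : ℝ) ^ p * N j)) ^ (1 / ((p : ℝ) - ((j : ℕ) : ℝ)))

/-- The tail `∑_{k ≥ p} (1/ν_k)^{1/r}`, with value in `[0, ∞]`. -/
def tail (r : ℝ) (N : ℕ → ℝ) (p : ℕ) : ℝ≥0∞ :=
  ∑' k : ℕ, ENNReal.ofReal ((1 / quot N (p + k)) ^ (1 / r))

/-- Condition `(M,N)_{SV_r}`: for some integer `s ≥ 1`,
`sup_{p ≥ 1} (λ_{p,s}^{M,N})^{1/r} / p * ∑_{k ≥ p} (1/ν_k)^{1/r} < ∞`. -/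
def CondSV (r : ℝ) (M N : ℕ → ℝ) : Prop :=
  ∃ s : ℕ, 1 ≤ s ∧
    (⨆ p : {p : ℕ // 1 ≤ p},
      ENNReal.ofReal (lam M N p s ^ (1 / r) / ((p : ℕ) : ℝ)) * tail r N p) < ⊤

/-- Condition `(M,N)_{γ_r}`: `sup_{p ≥ 1} (μ_p)^{1/r} / p * ∑_{k ≥ p} (1/ν_k)^{1/r} < ∞`.
For `N = M` this is the condition `(γ_r)` of Schmets and Valdivia. -/
def CondGamma (r : ℝ) (M N : ℕ → ℝ) : Prop :=
  (⨆ p : {p : ℕ // 1 ≤ p},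
    ENNReal.ofReal (quot M p ^ (1 / r) / ((p : ℕ) : ℝ)) * tail r N p) < ⊤

/-- `Λ_{M,h}`: complex sequences with `sup_p |a_p| / (h^p M_p) < ∞`. -/
def seqSpace (M : ℕ → ℝ) (h : ℝ) : Set (ℕ → ℂ) :=
  {a | BddAbove (Set.range fun p : ℕ => ‖a p‖ / (h ^ p * M p))}

/-- `Λ_{{M}}` (Roumieu type). -/
def seqRoumieu (M : ℕ → ℝ) : Set (ℕ → ℂ) :=
  {a | ∃ h : ℝ, 0 < h ∧ a ∈ seqSpace M h}

/-- `Λ_{(M)}` (Beurling type). -/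
def seqBeurling (M : ℕ → ℝ) : Set (ℕ → ℂ) :=
  {a | ∀ h : ℝ, 0 < h → a ∈ seqSpace M h}

/-- `D_{r,M,h}([-a,a])`: smooth `f : ℝ → ℂ` with support in `[-a,a]`, with `f^{(rn+j)}(0) = 0` for
all `n` and `1 ≤ j ≤ r - 1`, and with `sup_{n,x} |f^{(rn)}(x)| / (h^n M_n) < ∞`. -/
structure MemTest (r : ℕ) (M : ℕ → ℝ) (h a : ℝ) (f : ℝ → ℂ) : Prop where
  smooth : ContDiff ℝ ∞ f
  supp : tsupport f ⊆ Set.Icc (-a) a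
  vanish : ∀ n j : ℕ, 1 ≤ j → j < r → iteratedDeriv (r * n + j) f 0 = 0
  bound : BddAbove
    (Set.range fun q : ℕ × ℝ => ‖iteratedDeriv (r * q.1) f q.2‖ / (h ^ q.1 * M q.1))

/-- `D_{r,{M}}([-a,a])` (Roumieu type). -/
def testRoumieu (r : ℕ) (M : ℕ → ℝ) (a : ℝ) : Set (ℝ → ℂ) :=
  {f | ∃ h : ℝ, 0 < h ∧ MemTest r M h a f}

/-- `D_{r,(M)}([-a,a])` (Beurling type). -/
def testBeurling (r : ℕ) (M : ℕ → ℝ) (a : ℝ) : Set (ℝ → ℂ) :=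
  {f | ∀ h : ℝ, 0 < h → MemTest r M h a f}

/-- `f ↦ (f^{(rj)}(0))_j`. -/
def jet (r : ℕ) (f : ℝ → ℂ) : ℕ → ℂ := fun j => iteratedDeriv (r * j) f 0

theorem MemTest.jet_mem {r : ℕ} {M : ℕ → ℝ} {h a : ℝ} {f : ℝ → ℂ} (hf : MemTest r M h a f) :
    jet r f ∈ seqSpace M h := by
  refine hf.bound.mono ?_
  rintro _ ⟨p, rfl⟩
  exact ⟨(p, 0), rfl⟩

/-- The `r`-ramified Borel map `D_{r,{M}}([-1,1]) → Λ_{{M}}`. -/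
def borelRoumieu (r : ℕ) (M : ℕ → ℝ) (f : testRoumieu r M 1) : seqRoumieu M :=
  ⟨jet r f.1, f.2.imp fun _ hh => ⟨hh.1, hh.2.jet_mem⟩⟩

/-- The `r`-ramified Borel map `D_{r,(M)}([-1,1]) → Λ_{(M)}`. -/
def borelBeurling (r : ℕ) (M : ℕ → ℝ) (f : testBeurling r M 1) : seqBeurling M :=
  ⟨jet r f.1, fun h hh => (f.2 h hh).jet_mem⟩

end RamifiedBorel

end

namespace RamifiedBorel

/-! Everything is compared with `(γ_r)`, written as `GammaBound`. Repeating each `μ_n^{1/r}` exactly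
`r` times gives the nondecreasing quotients `τ = ramQuot r M`, whose products satisfy `weight τ (r
n) = M n`. A Landau–Kolmogorov inequality turns bounds on the derivatives of order `r n` into bounds
by `weight τ` on all derivatives, and `(γ_r)` yields the tail bound `∑_{i ≥ p} 1/τ_i ≤ C (p + 1) /
τ_p`. Ramification then only asks for jets supported on multiples of `r`.

Sufficiency. Averaging a trapezoid over infinitely many lengths `a_j` gives a cutoff whose `k`-th
derivative is at most `∏_{j<k} 1/a_j`. The tail bound permits such lengths with total `O((p +
1)/τ_p)`; on that scale `x^p/p!` times the cutoff has jet `δ_p`, with optimal bounds up to a factor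
`const^p` (`TailBound.exists_unit_jet`). Dilating by `t_p` absorbs this factor, and the dilated
functions are summed (`TailBound.exists_of_jet`). A constant `t_p` serves the Roumieu case, `t_p →
0` the Beurling case.

Necessity. Surjectivity realises every sequence with entries in `{0, v_i}`. These form a Cantor
space covered by closed sets of jets with fixed bounds, so Baire's theorem and a subtraction give
uniformly bounded functions with a single nonzero derivative at `0` (`exists_uniform_bound`). Let
`G` have jet `δ_{2Q}`. Then `G^{(Q)} - x^Q/Q!` is flat at `0`, so Bang's argument
(`IsDerivChain.norm_le_of_flat`) keeps it small over a length comparable to a tail of `∑ 1/τ_i`; but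
at distance `const · Q/τ_Q` the monomial dominates. Hence the tail is `O(Q/τ_Q)`
(`IsDerivChain.sum_inv_le`), which is `(γ_r)`. In the Beurling case the test values are `M_p/g_p^p`
with an arbitrary `g → ∞`, and a diagonal choice of `g` reduces the loss to a fixed `s^p`.

Condition `SV_r` is equivalent to `(γ_r)` because `λ_{p,1} ≤ μ_p` and `μ_q ≤ s² λ_{2q,s}`. -/

/-! ### Chains of derivatives -/

/-- A sequence of functions each of which is the derivative of its predecessor. -/
def IsDerivChain (F : ℕ → ℝ → ℂ) : Prop :=
  ∀ m x, HasDerivAt (F m) (F (m + 1) x) x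

theorem IsDerivChain.iteratedDeriv_eq {F : ℕ → ℝ → ℂ} (hF : IsDerivChain F) (m : ℕ) :
    iteratedDeriv m (F 0) = F m := by
  induction m with
  | zero => exact iteratedDeriv_zero
  | succ m ih =>
    rw [iteratedDeriv_succ, ih]
    exact funext fun x => (hF m x).deriv

theorem IsDerivChain.contDiff {F : ℕ → ℝ → ℂ} (hF : IsDerivChain F) : ContDiff ℝ ∞ (F 0) :=
  contDiff_of_differentiable_iteratedDeriv fun m _ => by
    rw [hF.iteratedDeriv_eq m]
    exact fun x => (hF m x).differentiableAt

theorem isDerivChain_iteratedDeriv {f : ℝ → ℂ} (hf : ContDiff ℝ ∞ f) :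
    IsDerivChain fun m => iteratedDeriv m f := fun m x => by
  have h : Differentiable ℝ (iteratedDeriv m f) :=
    hf.differentiable_iteratedDeriv m (mod_cast WithTop.coe_lt_top _)
  simpa only [iteratedDeriv_succ] using (h x).hasDerivAt

/-! ### Iterated averages -/

/-- The mean of `g` over `[x - a, x + a]`. -/
noncomputable def average (a : ℝ) (g : ℝ → ℂ) (x : ℝ) : ℂ :=
  ((2 * a)⁻¹ : ℝ) • ∫ t in (x - a)..(x + a), g t

theorem norm_average_sub_le {a : ℝ} (ha : 0 < a) {g : ℝ → ℂ} (hg : Continuous g) {x ε : ℝ} {c : ℂ}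
    (h : ∀ t, |t - x| ≤ a → ‖g t - c‖ ≤ ε) : ‖average a g x - c‖ ≤ ε := by
  have hc : c = ((2 * a)⁻¹ : ℝ) • ∫ _t in (x - a)..(x + a), c := by
    rw [intervalIntegral.integral_const, smul_smul]
    have : (2 * a)⁻¹ * (x + a - (x - a)) = 1 := by field_simp; ring
    rw [this, one_smul]
  have h1 : average a g x - c = ((2 * a)⁻¹ : ℝ) • ∫ t in (x - a)..(x + a), (g t - c) := by
    rw [intervalIntegral.integral_sub (hg.intervalIntegrable _ _) (by simp), smul_sub, ← hc]
    rfl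
  have h2 : ‖∫ t in (x - a)..(x + a), (g t - c)‖ ≤ ε * |x + a - (x - a)| := by
    refine intervalIntegral.norm_integral_le_of_norm_le_const fun t ht => h t ?_
    rw [Set.uIoc_of_le (by linarith)] at ht
    rw [abs_le]
    constructor <;> linarith [ht.1, ht.2]
  rw [h1, norm_smul, Real.norm_eq_abs, abs_of_pos (by positivity)]
  calc (2 * a)⁻¹ * ‖∫ t in (x - a)..(x + a), (g t - c)‖
      ≤ (2 * a)⁻¹ * (ε * |x + a - (x - a)|) := by gcongr
    _ = ε := by
      rw [show x + a - (x - a) = 2 * a by ring, abs_of_pos (by positivity)]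
      field_simp

theorem average_sub_average (a : ℝ) {g k : ℝ → ℂ} (hg : Continuous g) (hk : Continuous k) (x : ℝ) :
    average a g x - average a k x = average a (fun t => g t - k t) x := by
  rw [average, average, average, intervalIntegral.integral_sub (hg.intervalIntegrable _ _)
    (hk.intervalIntegrable _ _), smul_sub]

theorem hasDerivAt_average (a : ℝ) {g : ℝ → ℂ} (hg : Continuous g) (x : ℝ) :
    HasDerivAt (average a g) (((2 * a)⁻¹ : ℝ) • (g (x + a) - g (x - a))) x := by
  have key : ∀ y, HasDerivAt (fun u => ∫ t in (0 : ℝ)..u, g t) (g y) y := fun y =>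
    intervalIntegral.integral_hasDerivAt_right (hg.intervalIntegrable _ _)
      (hg.stronglyMeasurableAtFilter _ _) hg.continuousAt
  have h1 : HasDerivAt (fun y => ∫ t in (0 : ℝ)..(y + a), g t) (g (x + a)) x :=
    (key (x + a)).comp_add_const x a
  have h2 : HasDerivAt (fun y => ∫ t in (0 : ℝ)..(y - a), g t) (g (x - a)) x :=
    (key (x - a)).comp_sub_const x a
  refine ((h1.sub h2).const_smul ((2 * a)⁻¹ : ℝ)).congr_of_eventuallyEq
    (Eventually.of_forall fun y => ?_)
  simp only [average, Pi.smul_apply, Pi.sub_apply]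
  rw [intervalIntegral.integral_interval_sub_left] <;> exact hg.intervalIntegrable _ _

theorem continuous_average (a : ℝ) {g : ℝ → ℂ} (hg : Continuous g) : Continuous (average a g) :=
  continuous_iff_continuousAt.2 fun x => (hasDerivAt_average a hg x).continuousAt

/-- `n` successive averages of `g`, over the lengths `a m, …, a (m + n - 1)`. -/
noncomputable def iterAverage (a : ℕ → ℝ) (g : ℝ → ℂ) : ℕ → ℕ → ℝ → ℂ
  | 0, _ => g
  | n + 1, m => average (a m) (iterAverage a g n (m + 1))

section

variable {a : ℕ → ℝ} {g : ℝ → ℂ}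

theorem continuous_iterAverage (a : ℕ → ℝ) (hg : Continuous g) (n m : ℕ) :
    Continuous (iterAverage a g n m) := by
  induction n generalizing m with
  | zero => exact hg
  | succ n ih => exact continuous_average _ (ih _)

theorem norm_iterAverage_sub_le (ha : ∀ j, 0 < a j) (hs : Summable a) (hg : Continuous g)
    {c : ℂ} {ε : ℝ} (n m : ℕ) {x : ℝ} (h : ∀ t, |t - x| ≤ ∑' j, a (m + j) → ‖g t - c‖ ≤ ε) :
    ‖iterAverage a g n m x - c‖ ≤ ε := by
  induction n generalizing m x with
  | zero =>
    refine h x ?_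
    simpa using tsum_nonneg fun j => (ha (m + j)).le
  | succ n ih =>
    refine norm_average_sub_le (ha m) (continuous_iterAverage a hg _ _) fun t ht => ?_
    refine ih _ fun u hu => h u ?_
    have hs' : Summable fun j => a (m + j) := hs.comp_injective (add_right_injective m)
    rw [hs'.tsum_eq_zero_add]
    have h3 : ∀ j, a (m + 1 + j) = a (m + (j + 1)) := fun j => by congr 1; ring
    simp only [h3] at hu
    calc |u - x| ≤ |u - t| + |t - x| := abs_sub_le _ _ _
      _ ≤ _ := by rw [add_zero]; linarith

/-- The two sides differ only by the innermost average, which moves a Lipschitz function by at most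
`L` times its length; the outer averages do not increase the distance. Summability of `a` then gives
uniform convergence. -/
theorem dist_iterAverage_succ_le {L : NNReal} (ha : ∀ j, 0 < a j) (hg : LipschitzWith L g)
    (n m : ℕ) (x : ℝ) :
    dist (iterAverage a g n m x) (iterAverage a g (n + 1) m x) ≤ L * a (m + n) := by
  induction n generalizing m x with
  | zero =>
    rw [dist_comm, dist_eq_norm]
    refine norm_average_sub_le (ha m) hg.continuous fun t ht => ?_
    rw [← dist_eq_norm]
    refine (hg.dist_le_mul t x).trans ?_
    rw [Real.dist_eq]
    exact mul_le_mul_of_nonneg_left ht L.2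
  | succ n ih =>
    have hc := fun n m => continuous_iterAverage a hg.continuous n m
    rw [dist_eq_norm, iterAverage, iterAverage, average_sub_average _ (hc _ _) (hc _ _),
      ← sub_zero (average _ _ _)]
    refine norm_average_sub_le (ha m) ((hc _ _).sub (hc _ _)) fun t _ => ?_
    have := ih (m + 1) t
    rw [dist_eq_norm] at this
    rwa [sub_zero, show m + (n + 1) = m + 1 + n by ring]

/-- Averaging `g` over infinitely many lengths with a finite sum. -/
theorem exists_iterAverage_limit {L : NNReal} (ha : ∀ j, 0 < a j) (hs : Summable a)
    (hg : LipschitzWith L g) :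
    ∃ G : ℕ → ℝ → ℂ, (∀ m, Continuous (G m)) ∧ (∀ m, G m = average (a m) (G (m + 1))) ∧
      ∀ m x c ε, (∀ t, |t - x| ≤ ∑' j, a (m + j) → ‖g t - c‖ ≤ ε) → ‖G m x - c‖ ≤ ε := by
  have hsm : ∀ m, Summable fun n => (L : ℝ) * a (m + n) := fun m =>
    (hs.comp_injective (add_right_injective m)).mul_left _
  have hlim : ∀ m x, ∃ y, Tendsto (fun n => iterAverage a g n m x) atTop (𝓝 y) := fun m x =>
    cauchySeq_tendsto_of_complete (cauchySeq_of_dist_le_of_summable _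
      (fun n => dist_iterAverage_succ_le ha hg n m x) (hsm m))
  choose G hG using hlim
  have hc := fun n m => continuous_iterAverage a hg.continuous n m
  have hunif : ∀ m, TendstoUniformly (fun n => iterAverage a g n m) (G m) atTop := by
    intro m
    rw [Metric.tendstoUniformly_iff]
    intro ε hε
    have h0 := tendsto_sum_nat_add fun n => (L : ℝ) * a (m + n)
    filter_upwards [h0.eventually_lt_const hε] with n hn x
    rw [dist_comm]
    refine lt_of_le_of_lt (dist_le_tsum_of_dist_le_of_tendsto _
      (fun n => dist_iterAverage_succ_le ha hg n m x) (hsm m) (hG m x) n) ?_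
    simpa only [add_comm] using hn
  have hGc : ∀ m, Continuous (G m) := fun m =>
    (hunif m).continuous (Frequently.of_forall fun n => hc n m)
  refine ⟨G, hGc, fun m => funext fun x => ?_, fun m x c ε h => ?_⟩
  · refine tendsto_nhds_unique ((hG m x).comp (tendsto_add_atTop_nat 1)) ?_
    rw [Metric.tendsto_atTop]
    intro ε hε
    obtain ⟨N, hN⟩ := eventually_atTop.1 (Metric.tendstoUniformly_iff.1 (hunif (m + 1)) _ (half_pos hε))
    refine ⟨N, fun n hn => ?_⟩
    rw [dist_eq_norm]
    refine lt_of_le_of_lt ?_ (half_lt_self hε)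
    simp only [Function.comp_apply, iterAverage]
    rw [average_sub_average _ (hc _ _) (hGc _), ← sub_zero (average _ _ _)]
    refine norm_average_sub_le (ha m) ((hc _ _).sub (hGc _)) fun t _ => ?_
    have := (hN n hn t).le
    rwa [dist_comm, dist_eq_norm, ← sub_zero (_ - _)] at this
  · exact le_of_tendsto ((hG m x).sub_const c).norm
      (Eventually.of_forall fun n => norm_iterAverage_sub_le ha hs hg.continuous n m h)

/-! ### Difference quotients and cutoff functions -/

/-- Iterated symmetric difference quotients of the members of a sequence. -/
noncomputable def iterDiff (a : ℕ → ℝ) (G : ℕ → ℝ → ℂ) : ℕ → ℕ → ℝ → ℂ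
  | 0, m => G m
  | k + 1, m => fun x =>
    ((2 * a m)⁻¹ : ℝ) • (iterDiff a G k (m + 1) (x + a m) - iterDiff a G k (m + 1) (x - a m))

/-- Differentiating an average over `[x - a, x + a]` gives a symmetric difference quotient of the
averaged function. Each derivative thus uses up one average, so infinitely many averages give a
smooth function. -/
theorem hasDerivAt_iterDiff {G : ℕ → ℝ → ℂ} (hc : ∀ m, Continuous (G m))
    (hG : ∀ m, G m = average (a m) (G (m + 1))) (k m : ℕ) (x : ℝ) :
    HasDerivAt (iterDiff a G k m) (iterDiff a G (k + 1) m x) x := by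
  induction k generalizing m x with
  | zero =>
    have h := hasDerivAt_average (a m) (hc (m + 1)) x
    rw [← hG m] at h
    exact h
  | succ k ih =>
    exact (((ih (m + 1) (x + a m)).comp_add_const x (a m)).sub
      ((ih (m + 1) (x - a m)).comp_sub_const x (a m))).const_smul
      ((2 * a m)⁻¹ : ℝ)

theorem norm_iterDiff_le (ha : ∀ j, 0 < a j) {G : ℕ → ℝ → ℂ} (hb : ∀ m x, ‖G m x‖ ≤ 1)
    (k m : ℕ) (x : ℝ) : ‖iterDiff a G k m x‖ ≤ ∏ j ∈ Finset.range k, (a (m + j))⁻¹ := by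
  induction k generalizing m x with
  | zero => simpa [iterDiff] using hb m x
  | succ k ih =>
    rw [iterDiff, norm_smul, Real.norm_eq_abs, abs_of_pos (inv_pos.2 (mul_pos two_pos (ha m))),
      Finset.prod_range_succ']
    have h3 : ∀ j, a (m + 1 + j) = a (m + (j + 1)) := fun j => by congr 1; ring
    have h1 := ih (m + 1) (x + a m)
    have h2 := ih (m + 1) (x - a m)
    simp only [h3] at h1 h2
    set p := ∏ j ∈ Finset.range k, (a (m + (j + 1)))⁻¹
    have ham := ha m
    calc (2 * a m)⁻¹ * ‖iterDiff a G k (m + 1) (x + a m) - iterDiff a G k (m + 1) (x - a m)‖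
        ≤ (2 * a m)⁻¹ * (p + p) := by
          gcongr
          exact (norm_sub_le _ _).trans (add_le_add h1 h2)
      _ = p * (a (m + 0))⁻¹ := by rw [add_zero]; field_simp; ring

end

/-- The piecewise linear function equal to `1` on `[-2 w, 2 w]` and to `0` outside `[-3 w, 3 w]`. -/
noncomputable def trapezoid (w x : ℝ) : ℂ := ((max 0 (min 1 (3 - |x| / w)) : ℝ) : ℂ)

theorem lipschitzWith_trapezoid {w : ℝ} (hw : 0 < w) :
    LipschitzWith (Real.toNNReal w⁻¹) (trapezoid w) := by
  refine LipschitzWith.of_dist_le_mul fun x y => ?_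
  rw [Real.coe_toNNReal _ (inv_pos.2 hw).le, trapezoid, trapezoid, dist_eq_norm,
    ← Complex.ofReal_sub, Complex.norm_real, Real.norm_eq_abs]
  refine (abs_max_sub_max_le_max _ _ _ _).trans ?_
  rw [sub_self, abs_zero]
  refine max_le (by positivity) ((abs_min_sub_min_le_max _ _ _ _).trans ?_)
  rw [sub_self, abs_zero]
  refine max_le (by positivity) ?_
  rw [sub_sub_sub_cancel_left, ← sub_div, abs_div, abs_of_pos hw, div_eq_inv_mul, abs_sub_comm,
    Real.dist_eq]
  exact mul_le_mul_of_nonneg_left (abs_abs_sub_abs_le x y) (inv_pos.2 hw).le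

theorem norm_trapezoid_le (w x : ℝ) : ‖trapezoid w x‖ ≤ 1 := by
  rw [trapezoid, Complex.norm_real, Real.norm_eq_abs, abs_of_nonneg (le_max_left _ _)]
  simp

theorem trapezoid_eq_one {w x : ℝ} (hw : 0 < w) (hx : |x| ≤ 2 * w) : trapezoid w x = 1 := by
  have h : |x| / w ≤ 2 := by rwa [div_le_iff₀ hw]
  rw [trapezoid, min_eq_left (by linarith)]
  simp

theorem trapezoid_eq_zero {w x : ℝ} (hw : 0 < w) (hx : 3 * w ≤ |x|) : trapezoid w x = 0 := by
  have h : 3 ≤ |x| / w := by rwa [le_div_iff₀ hw]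
  rw [trapezoid, max_eq_left ((min_le_right _ _).trans (by linarith))]
  simp

/-- A cutoff function whose `k`-th derivative is controlled by the product of `k` prescribed
numbers. -/
theorem exists_cutoff {a : ℕ → ℝ} (ha : ∀ j, 0 < a j) (hs : Summable a) :
    ∃ θ : ℝ → ℂ, ContDiff ℝ ∞ θ ∧ (∀ x, |x| ≤ ∑' j, a j → θ x = 1) ∧
      (∀ x, 4 * ∑' j, a j ≤ |x| → θ x = 0) ∧
      ∀ k x, ‖iteratedDeriv k θ x‖ ≤ ∏ j ∈ Finset.range k, (a j)⁻¹ := by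
  -- All averages together reach at most a distance `w`, so the plateau `|x| ≤ 2w` of the trapezoid
  -- shrinks to `|x| ≤ w` and its support `|x| ≤ 3w` grows to `|x| ≤ 4w`.
  set w := ∑' j, a j with hwdef
  have hw : 0 < w := hs.tsum_pos (fun j => (ha j).le) 0 (ha 0)
  obtain ⟨G, hGc, hGa, hGb⟩ := exists_iterAverage_limit ha hs (lipschitzWith_trapezoid hw)
  have hchain : IsDerivChain fun k => iterDiff a G k 0 := fun k x =>
    hasDerivAt_iterDiff hGc hGa k 0 x
  have hG1 : ∀ m x, ‖G m x‖ ≤ 1 := fun m x => by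
    simpa using hGb m x 0 1 fun t _ => by simpa using norm_trapezoid_le w t
  refine ⟨G 0, hchain.contDiff, fun x hx => ?_, fun x hx => ?_, fun k x => ?_⟩
  · refine sub_eq_zero.1 (norm_le_zero_iff.1 (hGb 0 x 1 0 fun t ht => ?_))
    simp only [zero_add, ← hwdef] at ht
    rw [trapezoid_eq_one hw, sub_self, norm_zero]
    have := abs_sub_abs_le_abs_sub t x
    linarith
  · refine norm_le_zero_iff.1 ?_
    rw [← sub_zero (G 0 x)]
    refine hGb 0 x 0 0 fun t ht => ?_
    simp only [zero_add, ← hwdef] at ht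
    rw [trapezoid_eq_zero hw, sub_self, norm_zero]
    have := abs_sub_abs_le_abs_sub x t
    rw [abs_sub_comm] at this
    linarith
  · have h := hchain.iteratedDeriv_eq k
    simp only [iterDiff] at h
    rw [h]
    simpa using norm_iterDiff_le ha hG1 k 0 x

/-! ### Monomials -/

/-- The `k`-th derivative of `x ^ p / p!`. -/
noncomputable def monomialDeriv (p k : ℕ) (x : ℝ) : ℂ :=
  if k ≤ p then ((x ^ (p - k) / ((p - k)! : ℝ) : ℝ) : ℂ) else 0

theorem isDerivChain_monomialDeriv (p : ℕ) : IsDerivChain (monomialDeriv p) := by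
  intro k x
  rcases lt_trichotomy k p with h | rfl | h
  · obtain ⟨i, rfl⟩ := Nat.exists_eq_add_of_lt h
    have e1 : monomialDeriv (k + i + 1) k =
        fun x : ℝ => ((x ^ (i + 1) / ((i + 1)! : ℝ) : ℝ) : ℂ) := by
      funext y
      rw [monomialDeriv, if_pos (by omega), show k + i + 1 - k = i + 1 by omega]
    have e2 : monomialDeriv (k + i + 1) (k + 1) x = ((x ^ i / (i ! : ℝ) : ℝ) : ℂ) := by
      rw [monomialDeriv, if_pos (by omega), show k + i + 1 - (k + 1) = i by omega]
    rw [e1, e2]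
    refine HasDerivAt.ofReal_comp ?_
    refine ((hasDerivAt_pow (i + 1) x).div_const _).congr_deriv ?_
    rw [Nat.factorial_succ]
    push_cast
    field_simp
  · have e1 : monomialDeriv k k = fun _ => 1 := by
      funext y
      simp [monomialDeriv]
    rw [e1, monomialDeriv, if_neg (by omega)]
    exact hasDerivAt_const _ _
  · have e1 : monomialDeriv p k = fun _ => 0 := by
      funext y
      rw [monomialDeriv, if_neg (by omega)]
    rw [e1, monomialDeriv, if_neg (by omega)]
    exact hasDerivAt_const _ _

theorem monomialDeriv_zero_right (p k : ℕ) : monomialDeriv p k 0 = if k = p then 1 else 0 := by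
  rw [monomialDeriv]
  split_ifs with h1 h2 h2
  · simp [h2]
  · rw [zero_pow (by omega)]; simp
  · omega
  · rfl

/-- Replacing `y^i/i!` by `e^y` leaves only a geometric dependence on `k`. It is used with `y`
proportional to `p` or `p + 1`, where `e^y` is a harmless exponential factor. -/
theorem norm_monomialDeriv_le {p k : ℕ} {x y s : ℝ} (hs : 0 < s) (hy : 0 ≤ y) (hx : |x| ≤ y / s) :
    ‖monomialDeriv p k x‖ ≤ Real.exp y * s ^ k / s ^ p := by
  rw [monomialDeriv]
  split_ifs with h
  · obtain ⟨i, rfl⟩ := Nat.exists_eq_add_of_le h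
    rw [Nat.add_sub_cancel_left, Complex.norm_real, Real.norm_eq_abs, abs_div, abs_pow,
      abs_of_pos (a := ((i ! : ℕ) : ℝ)) (by positivity)]
    calc |x| ^ i / (i ! : ℝ) ≤ (y / s) ^ i / (i ! : ℝ) := by gcongr
      _ = y ^ i / (i ! : ℝ) * (s ^ k / s ^ (k + i)) := by rw [div_pow, pow_add]; field_simp
      _ ≤ Real.exp y * (s ^ k / s ^ (k + i)) := by
        gcongr
        exact Real.pow_div_factorial_le_exp y hy i
      _ = _ := by ring
  · rw [norm_zero]; positivity

/-! ### Weights -/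

/-- The sequence with quotients `τ 0, τ 1, …` and initial value `1`. -/
noncomputable def weight (τ : ℕ → ℝ) (n : ℕ) : ℝ := ∏ i ∈ Finset.range n, τ i

section

variable {τ : ℕ → ℝ}

theorem weight_pos (hτ : ∀ i, 0 < τ i) (n : ℕ) : 0 < weight τ n :=
  Finset.prod_pos fun i _ => hτ i

theorem weight_succ (τ : ℕ → ℝ) (n : ℕ) : weight τ (n + 1) = weight τ n * τ n :=
  Finset.prod_range_succ _ _

theorem weight_mul_pow_le (hτ : ∀ i, 0 < τ i) (hm : Monotone τ) {n k : ℕ} (hk : k ≤ n) {s : ℝ}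
    (hs : 0 ≤ s) (h : s ≤ τ (n - k)) : weight τ (n - k) * s ^ k ≤ weight τ n := by
  obtain ⟨i, rfl⟩ := Nat.exists_eq_add_of_le' hk
  rw [Nat.add_sub_cancel] at h ⊢
  rw [weight, weight, Finset.prod_range_add]
  refine mul_le_mul_of_nonneg_left ?_ (weight_pos hτ i).le
  calc s ^ k = ∏ _j ∈ Finset.range k, s := by simp
    _ ≤ _ := Finset.prod_le_prod (fun _ _ => hs) fun j _ => h.trans (hm (by omega))

/-- For `n ≥ p` the two sides agree; for `n < p` the factors missing on the right are at most `τ p`.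
This is the price of raising the first `p` quotients to `τ p`; the factor `τ p ^ p` cancels against
the one in the bound for the monomial of degree `p`. -/
theorem weight_max_mul_le (hτ : ∀ i, 0 < τ i) (hm : Monotone τ) (p n : ℕ) :
    weight τ p * weight (fun j => max (τ j) (τ p)) n ≤ τ p ^ p * weight τ n := by
  rcases le_total n p with h | h
  · have e : weight (fun j => max (τ j) (τ p)) n = τ p ^ n := by
      rw [weight, Finset.prod_congr rfl fun j hj => max_eq_right (hm (by
        have := Finset.mem_range.1 hj; omega))]
      simp
    obtain ⟨i, rfl⟩ := Nat.exists_eq_add_of_le h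
    rw [e, weight, weight, Finset.prod_range_add, pow_add]
    have : ∏ x ∈ Finset.range i, τ (n + x) ≤ τ (n + i) ^ i := by
      calc _ ≤ ∏ _x ∈ Finset.range i, τ (n + i) :=
            Finset.prod_le_prod (fun _ _ => (hτ _).le) fun j hj => hm (by
              have := Finset.mem_range.1 hj; omega)
        _ = _ := by simp
    have h1 := weight_pos hτ n
    have h2 := pow_pos (hτ (n + i)) n
    rw [weight] at h1
    calc _ = (τ (n + i) ^ n * ∏ x ∈ Finset.range n, τ x) * ∏ x ∈ Finset.range i, τ (n + x) := by
          ring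
      _ ≤ (τ (n + i) ^ n * ∏ x ∈ Finset.range n, τ x) * τ (n + i) ^ i := by gcongr
      _ = _ := by ring
  · obtain ⟨i, rfl⟩ := Nat.exists_eq_add_of_le h
    refine le_of_eq ?_
    rw [weight, weight, weight, Finset.prod_range_add, Finset.prod_range_add,
      Finset.prod_congr rfl fun j hj => max_eq_right (hm (by
        have := Finset.mem_range.1 hj; omega : j ≤ p)),
      Finset.prod_congr (g := fun j => τ (p + j)) rfl fun j _ =>
        max_eq_left (hm (by omega : p ≤ p + j))]
    simp only [Finset.prod_const, Finset.card_range]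
    ring

theorem exists_weight_le_pow {u : ℕ → ℝ} (hu : ∀ j, 0 < u j) {δ : ℝ} (hδ : 0 < δ)
    (h : ∀ᶠ j in atTop, u j ≤ δ) : ∃ B, 0 < B ∧ ∀ n, weight u n ≤ B * δ ^ n := by
  obtain ⟨N, hN⟩ := eventually_atTop.1 h
  have hp : ∀ i, 0 < weight u i / δ ^ i := fun i => div_pos (weight_pos hu i) (pow_pos hδ i)
  refine ⟨∑ i ∈ Finset.range (N + 1), weight u i / δ ^ i,
    Finset.sum_pos (fun i _ => hp i) ⟨0, by simp⟩, fun n => ?_⟩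
  rw [← div_le_iff₀ (pow_pos hδ n)]
  have hs : ∀ i ≤ N, weight u i / δ ^ i ≤ ∑ i ∈ Finset.range (N + 1), weight u i / δ ^ i :=
    fun i hi => Finset.single_le_sum (f := fun i => weight u i / δ ^ i) (fun i _ => (hp i).le)
      (Finset.mem_range.2 (by omega))
  induction n with
  | zero => exact hs 0 (Nat.zero_le _)
  | succ n ih =>
    rcases le_or_gt (n + 1) N with h1 | h1
    · exact hs _ h1
    · refine le_trans ?_ ih
      rw [weight_succ, pow_succ, mul_div_mul_comm]
      exact mul_le_of_le_one_right (hp n).le ((div_le_one hδ).2 (hN n (by omega)))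

end

/-! ### Tail bounds and averaging lengths -/

/-- A convergent series is dominated by a convergent series with much larger terms. -/
theorem exists_summable_ratio_tendsto {c : ℕ → ℝ} (hc : ∀ j, 0 < c j) (hs : Summable c) :
    ∃ b : ℕ → ℝ, (∀ j, c j ≤ b j) ∧ Summable b ∧ ∑' j, b j ≤ 2 * ∑' j, c j ∧
      Tendsto (fun j => b j / c j) atTop atTop := by
  set R : ℕ → ℝ := fun j => ∑' i, c (i + j) with hR
  have hsj : ∀ j, Summable fun i => c (i + j) := fun j => (summable_nat_add_iff j).2 hs
  have hRpos : ∀ j, 0 < R j := fun j => (hsj j).tsum_pos (fun i => (hc _).le) 0 (hc _)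
  have hRs : ∀ j, c j = R j - R (j + 1) := fun j => by
    have h1 : ∀ i, c (i + 1 + j) = c (i + (j + 1)) := fun i => by congr 1; ring
    simp only [hR]
    rw [(hsj j).tsum_eq_zero_add]
    simp only [h1, zero_add]
    ring
  have hR0 : R 0 = ∑' j, c j := by simp [hR]
  -- With `R j` the tails of the series, `c j = R j - R (j + 1)` gives `c j / √(R j) ≤ 2 (√(R j) -
  -- √(R (j + 1)))`, so `∑ e j` telescopes to at most `R 0`, while `e j / c j → ∞`.
  set e : ℕ → ℝ := fun j => 1 / 2 * (c j * √(R 0 / R j)) with he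
  have he0 : ∀ j, 0 ≤ e j := fun j => by have := hc j; positivity
  have hle : ∀ j, e j ≤ √(R 0) * (√(R j) - √(R (j + 1))) := by
    intro j
    have hx := Real.sqrt_pos.2 (hRpos j)
    have hy := Real.sqrt_pos.2 (hRpos (j + 1))
    have hxy : √(R (j + 1)) ≤ √(R j) := Real.sqrt_le_sqrt (by linarith [hRs j, hc j])
    have hcj : c j = (√(R j) - √(R (j + 1))) * (√(R j) + √(R (j + 1))) := by
      rw [hRs j]
      nth_rw 1 [← Real.sq_sqrt (hRpos j).le, ← Real.sq_sqrt (hRpos (j + 1)).le]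
      ring
    simp only [he]
    rw [Real.sqrt_div (hRpos 0).le, hcj]
    set x := √(R j)
    set y := √(R (j + 1))
    have : (x + y) / x ≤ 2 := by rw [div_le_iff₀ hx]; linarith
    calc 1 / 2 * ((x - y) * (x + y) * (√(R 0) / x))
        = √(R 0) * (x - y) * (1 / 2 * ((x + y) / x)) := by ring
      _ ≤ √(R 0) * (x - y) * (1 / 2 * 2) := by
        have : 0 ≤ x - y := by linarith
        gcongr
      _ = _ := by ring
  have hpart : ∀ n, ∑ i ∈ Finset.range n, e i ≤ R 0 := fun n => by
    calc ∑ i ∈ Finset.range n, e i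
        ≤ ∑ i ∈ Finset.range n, √(R 0) * (√(R i) - √(R (i + 1))) :=
          Finset.sum_le_sum fun i _ => hle i
      _ = √(R 0) * (√(R 0) - √(R n)) := by rw [← Finset.mul_sum, Finset.sum_range_sub']
      _ ≤ √(R 0) * √(R 0) := by
        have := Real.sqrt_nonneg (R n)
        gcongr
        linarith
      _ = R 0 := Real.mul_self_sqrt (hRpos 0).le
  have hse : Summable e := summable_of_sum_range_le he0 hpart
  refine ⟨fun j => c j + e j, fun j => by linarith [he0 j], hs.add hse, ?_, ?_⟩
  · rw [hs.tsum_add hse, ← hR0]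
    have := Real.tsum_le_of_sum_range_le he0 hpart
    linarith
  · have h1 : Tendsto R atTop (𝓝[>] 0) :=
      tendsto_nhdsWithin_iff.2 ⟨tendsto_sum_nat_add c, Eventually.of_forall hRpos⟩
    have h2 : Tendsto (fun j => R 0 / R j) atTop atTop := by
      simpa only [div_eq_mul_inv, Function.comp_def] using
        (tendsto_inv_nhdsGT_zero.comp h1).const_mul_atTop (hRpos 0)
    have h3 : Tendsto (fun j => 1 + 1 / 2 * √(R 0 / R j)) atTop atTop :=
      tendsto_atTop_add_const_left _ _
        ((Real.tendsto_sqrt_atTop.comp h2).const_mul_atTop (by norm_num))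
    refine h3.congr fun j => ?_
    have := hc j
    simp only [he]
    field_simp

/-- The tails of `∑ 1 / τ i` are at most `C (p + 1) / τ p`. -/
structure TailBound (τ : ℕ → ℝ) (C : ℝ) : Prop where
  pos : ∀ i, 0 < τ i
  mono : Monotone τ
  summable : Summable fun i => (τ i)⁻¹
  tail_le : ∀ p : ℕ, ∑' i, (τ (p + i))⁻¹ ≤ C * ((p + 1) / τ p)

section

variable {τ : ℕ → ℝ} {C : ℝ}

theorem TailBound.nonneg (h : TailBound τ C) : 0 ≤ C := by
  have h1 : 0 ≤ C * ((((0 : ℕ) : ℝ) + 1) / τ 0) :=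
    (tsum_nonneg fun i => (inv_pos.2 (h.pos _)).le).trans (h.tail_le 0)
  exact nonneg_of_mul_nonneg_left h1 (div_pos (by norm_num) (h.pos 0))

/-- The first `p` lengths equal `1 / τ p`, and the later ones slightly enlarge the series `∑ 1 / τ
j`. The first block costs `p / τ p` and the rest at most twice the tail. The divergence of `a j * τ
j` is what places the cutoff in the Beurling class. -/
theorem TailBound.exists_widths (h : TailBound τ C) (p : ℕ) :
    ∃ a : ℕ → ℝ, (∀ j, 0 < a j) ∧ Summable a ∧ ∑' j, a j ≤ (2 * C + 1) * ((p + 1) / τ p) ∧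
      (∀ j, (a j)⁻¹ ≤ max (τ j) (τ p)) ∧ Tendsto (fun j => a j * τ j) atTop atTop := by
  have hp := fun i => h.pos i
  obtain ⟨b, hb1, hb2, hb3, hb4⟩ := exists_summable_ratio_tendsto
    (c := fun i => (τ (p + i))⁻¹) (fun i => inv_pos.2 (hp _))
    (h.summable.comp_injective (add_right_injective p))
  have hbpos : ∀ j, 0 < b j := fun j => (inv_pos.2 (hp _)).trans_le (hb1 j)
  set a : ℕ → ℝ := fun j => if j < p then (τ p)⁻¹ else b (j - p) with ha
  have hap : ∀ j, a (j + p) = b j := fun j => by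
    simp [ha]
  have hs : Summable a := (summable_nat_add_iff p).1 (by simpa only [hap] using hb2)
  refine ⟨a, fun j => ?_, hs, ?_, fun j => ?_, ?_⟩
  · simp only [ha]
    split_ifs
    · exact inv_pos.2 (hp p)
    · exact hbpos _
  · rw [← hs.sum_add_tsum_nat_add p]
    simp only [hap]
    have h1 : ∑ i ∈ Finset.range p, a i = p * (τ p)⁻¹ := by
      rw [Finset.sum_congr rfl (g := fun _ => (τ p)⁻¹) fun i hi => by
        simp [ha, Finset.mem_range.1 hi]]
      simp
    rw [h1]
    have h2 := h.tail_le p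
    have h3 := hp p
    calc _ ≤ p * (τ p)⁻¹ + 2 * (C * ((p + 1) / τ p)) := by linarith
      _ ≤ (p + 1) * (τ p)⁻¹ + 2 * (C * ((p + 1) / τ p)) := by
        gcongr
        linarith
      _ = _ := by ring
  · simp only [ha]
    split_ifs with hj
    · rw [inv_inv]; exact le_max_right _ _
    · obtain ⟨i, rfl⟩ := Nat.exists_eq_add_of_le (not_lt.1 hj)
      rw [Nat.add_sub_cancel_left]
      refine le_max_of_le_left ?_
      rw [← inv_inv (τ (p + i))]
      exact inv_anti₀ (inv_pos.2 (hp _)) (hb1 i)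
  · rw [← tendsto_add_atTop_iff_nat p]
    simp only [hap]
    refine hb4.congr fun j => ?_
    rw [div_inv_eq_mul, add_comm]

/-! ### Functions with a single nonzero derivative at the origin -/

/-- Functions with jet `δ_p` at the origin, with optimal bounds, in the Beurling class. -/
theorem TailBound.exists_unit_jet (h : TailBound τ C) (p : ℕ) :
    ∃ χ : ℝ → ℂ, ContDiff ℝ ∞ χ ∧ (∀ n, iteratedDeriv n χ 0 = if n = p then 1 else 0) ∧
      (∀ x, 4 * (2 * C + 1) * ((p + 1) / τ p) ≤ |x| → χ x = 0) ∧
      (∀ n x, ‖iteratedDeriv n χ x‖ ≤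
        Real.exp (4 * (2 * C + 1) * (p + 1)) * 2 ^ n * (weight τ n / weight τ p)) ∧
      ∀ δ : ℝ, 0 < δ → ∃ B, ∀ n x, ‖iteratedDeriv n χ x‖ ≤ B * (δ ^ n * weight τ n) := by
  have hC := h.nonneg
  have hτ := h.pos
  obtain ⟨a, ha, hs, hsum, hinv, hlim⟩ := h.exists_widths p
  obtain ⟨θ, hθ, hθ1, hθ0, hθb⟩ := exists_cutoff ha hs
  set w := ∑' j, a j
  have hw : 0 < w := hs.tsum_pos (fun j => (ha j).le) 0 (ha 0)
  set y : ℝ := 4 * (2 * C + 1) * (p + 1) with hy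
  have hy0 : 0 ≤ y := by positivity
  have hwy : 4 * w ≤ y / τ p := by
    calc 4 * w ≤ 4 * ((2 * C + 1) * ((p + 1) / τ p)) := by linarith
      _ = _ := by rw [hy]; ring
  have hmono : ContDiff ℝ ∞ (monomialDeriv p 0) := (isDerivChain_monomialDeriv p).contDiff
  have hmd := fun n => (isDerivChain_monomialDeriv p).iteratedDeriv_eq n
  set χ : ℝ → ℂ := fun x => monomialDeriv p 0 x * θ x with hχ
  have hχc : ContDiff ℝ ∞ χ := hmono.mul hθ
  have hout : ∀ n x, y / τ p < |x| → iteratedDeriv n χ x = 0 := by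
    intro n x hx
    have he : χ =ᶠ[𝓝 x] fun _ => 0 := by
      filter_upwards [(isOpen_lt continuous_const continuous_abs).mem_nhds hx] with z hz
      simp only [hχ]
      rw [hθ0 z (hwy.trans (le_of_lt hz)), mul_zero]
    rw [he.iteratedDeriv_eq n, iteratedDeriv_fun_const_zero]
  have hleib : ∀ n x, |x| ≤ y / τ p → ‖iteratedDeriv n χ x‖ ≤ ∑ k ∈ Finset.range (n + 1),
      (n.choose k : ℝ) * ‖monomialDeriv p k x‖ * weight (fun j => (a j)⁻¹) (n - k) := by
    intro n x hx
    have h1 := norm_iteratedFDeriv_mul_le hmono hθ x (n := n) (mod_cast le_top)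
    simp only [norm_iteratedFDeriv_eq_norm_iteratedDeriv, hmd] at h1
    refine h1.trans (Finset.sum_le_sum fun k _ => ?_)
    gcongr
    exact hθb _ x
  have hchoose : ∀ n : ℕ, ∑ k ∈ Finset.range (n + 1), (n.choose k : ℝ) = 2 ^ n := fun n => by
    exact_mod_cast Nat.sum_range_choose n
  refine ⟨χ, hχc, fun n => ?_, fun x hx => ?_, fun n x => ?_, fun δ hδ => ?_⟩
  · have he : χ =ᶠ[𝓝 0] monomialDeriv p 0 := by
      filter_upwards [Metric.ball_mem_nhds (0 : ℝ) hw] with z hz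
      simp only [hχ]
      rw [hθ1 z (by simpa using (Metric.mem_ball.1 hz).le), mul_one]
    rw [he.iteratedDeriv_eq n, hmd, monomialDeriv_zero_right]
  · simp only [hχ]
    rw [hθ0 x (hwy.trans (le_trans (le_of_eq (by rw [hy]; ring)) hx)), mul_zero]
  · have hWn := weight_pos hτ n
    have hWp := weight_pos hτ p
    have hmaxpos : ∀ j, 0 < max (τ j) (τ p) := fun j => lt_max_of_lt_left (hτ j)
    have hmm : Monotone fun j => max (τ j) (τ p) := fun i j hij => max_le_max (h.mono hij) le_rfl
    rcases le_or_gt |x| (y / τ p) with hx | hx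
    · calc _ ≤ ∑ k ∈ Finset.range (n + 1), (n.choose k : ℝ) * ‖monomialDeriv p k x‖ *
            weight (fun j => (a j)⁻¹) (n - k) := hleib n x hx
        _ ≤ ∑ k ∈ Finset.range (n + 1), (n.choose k : ℝ) *
            (Real.exp y * (weight τ n / weight τ p)) := by
          refine Finset.sum_le_sum fun k hk => ?_
          rw [mul_assoc]
          refine mul_le_mul_of_nonneg_left ?_ (by positivity)
          have hk : k ≤ n := by have := Finset.mem_range.1 hk; omega
          have h1 := norm_monomialDeriv_le (p := p) (k := k) (hτ p) hy0 hx
          have h2 : weight (fun j => (a j)⁻¹) (n - k) ≤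
              weight (fun j => max (τ j) (τ p)) (n - k) :=
            Finset.prod_le_prod (fun j _ => (inv_pos.2 (ha j)).le) fun j _ => hinv j
          have h3 := weight_mul_pow_le hmaxpos hmm hk (hτ p).le (le_max_right _ _)
          have h4 := weight_max_mul_le hτ h.mono p n
          have h5 := pow_pos (hτ p) k
          have h6 := pow_pos (hτ p) p
          have h7 := weight_pos hmaxpos (n - k)
          calc _ ≤ Real.exp y * τ p ^ k / τ p ^ p *
                weight (fun j => max (τ j) (τ p)) (n - k) := by
                gcongr
                exact (weight_pos (fun j => inv_pos.2 (ha j)) _).le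
            _ = Real.exp y / τ p ^ p *
                (weight (fun j => max (τ j) (τ p)) (n - k) * τ p ^ k) := by ring
            _ ≤ Real.exp y / τ p ^ p * weight (fun j => max (τ j) (τ p)) n := by gcongr
            _ = Real.exp y / (τ p ^ p * weight τ p) *
                (weight τ p * weight (fun j => max (τ j) (τ p)) n) := by field_simp
            _ ≤ Real.exp y / (τ p ^ p * weight τ p) * (τ p ^ p * weight τ n) := by gcongr
            _ = _ := by field_simp
        _ = _ := by rw [← Finset.sum_mul, hchoose]; ring
    · rw [hout n x hx, norm_zero]
      positivity
  · have hu : ∀ j, 0 < (a j)⁻¹ * (τ j)⁻¹ := fun j => mul_pos (inv_pos.2 (ha j)) (inv_pos.2 (hτ j))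
    -- The rate `δ / 2` leaves room for the factor `2 ^ n` from the sum of the binomial
    -- coefficients.
    obtain ⟨B, hB, hBn⟩ := exists_weight_le_pow hu (half_pos hδ) (by
      filter_upwards [hlim.eventually_ge_atTop (δ / 2)⁻¹] with j hj
      rw [← mul_inv]
      exact inv_le_of_inv_le₀ (half_pos hδ) hj)
    have hBn' : ∀ n, weight (fun j => (a j)⁻¹) n ≤ B * (δ / 2) ^ n * weight τ n := fun n => by
      have e : weight (fun j => (a j)⁻¹ * (τ j)⁻¹) n * weight τ n =
          weight (fun j => (a j)⁻¹) n := by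
        rw [weight, weight, weight, ← Finset.prod_mul_distrib]
        refine Finset.prod_congr rfl fun j _ => ?_
        rw [mul_assoc, inv_mul_cancel₀ (hτ j).ne', mul_one]
      rw [← e]
      exact mul_le_mul_of_nonneg_right (hBn n) (weight_pos hτ n).le
    -- Derivatives of the monomial of order `k > p` vanish, so the `k`-th power of the ratio occurs
    -- only for `k ≤ p` and is bounded by `Z ^ p`, independently of `n`.
    set Z := max 1 (τ p / (τ 0 * (δ / 2))) with hZ
    refine ⟨Real.exp y / τ p ^ p * B * Z ^ p, fun n x => ?_⟩
    have hτp := hτ p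
    have hZ1 : 1 ≤ Z := le_max_left _ _
    have hWn := weight_pos hτ n
    rcases le_or_gt |x| (y / τ p) with hx | hx
    · calc _ ≤ ∑ k ∈ Finset.range (n + 1), (n.choose k : ℝ) * ‖monomialDeriv p k x‖ *
            weight (fun j => (a j)⁻¹) (n - k) := hleib n x hx
        _ ≤ ∑ k ∈ Finset.range (n + 1), (n.choose k : ℝ) *
            (Real.exp y / τ p ^ p * B * Z ^ p * ((δ / 2) ^ n * weight τ n)) := by
          refine Finset.sum_le_sum fun k hk => ?_
          rw [mul_assoc]
          refine mul_le_mul_of_nonneg_left ?_ (by positivity)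
          have hk : k ≤ n := by have := Finset.mem_range.1 hk; omega
          rcases le_or_gt k p with hkp | hkp
          · have h1 := norm_monomialDeriv_le (p := p) (k := k) (hτ p) hy0 hx
            have h2 := hBn' (n - k)
            have h3 := weight_mul_pow_le hτ h.mono hk (hτ 0).le (h.mono (Nat.zero_le _))
            have h4 : weight τ (n - k) ≤ weight τ n / τ 0 ^ k := by
              rwa [le_div_iff₀ (pow_pos (hτ 0) k)]
            have h5 := hτ 0
            have h6 := weight_pos hτ (n - k)
            calc _ ≤ (Real.exp y * τ p ^ k / τ p ^ p) *
                  (B * (δ / 2) ^ (n - k) * weight τ (n - k)) := by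
                  gcongr
                  exact (weight_pos (fun j => inv_pos.2 (ha j)) _).le
              _ ≤ (Real.exp y * τ p ^ k / τ p ^ p) *
                  (B * (δ / 2) ^ (n - k) * (weight τ n / τ 0 ^ k)) := by gcongr
              _ = Real.exp y / τ p ^ p * B * (τ p / (τ 0 * (δ / 2))) ^ k *
                  ((δ / 2) ^ n * weight τ n) := by
                  obtain ⟨i, rfl⟩ := Nat.exists_eq_add_of_le' hk
                  have h8 := half_pos hδ
                  generalize δ / 2 = η at h8 ⊢
                  rw [Nat.add_sub_cancel, pow_add η, div_pow, mul_pow]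
                  field_simp
              _ ≤ Real.exp y / τ p ^ p * B * Z ^ k * ((δ / 2) ^ n * weight τ n) := by
                  gcongr
                  exact le_max_right _ _
              _ ≤ _ := by gcongr
          · rw [monomialDeriv, if_neg (by omega), norm_zero, zero_mul]
            positivity
        _ = _ := by
          rw [← Finset.sum_mul, hchoose, div_pow]
          field_simp
    · rw [hout n x hx, norm_zero]
      positivity

end

/-! ### Borel's theorem by summation of dilated functions -/

theorem iteratedDeriv_tsum {F : ℕ → ℝ → ℂ} {v : ℕ → ℕ → ℝ} (hF : ∀ p, ContDiff ℝ ∞ (F p))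
    (hv : ∀ n, Summable (v n)) (h : ∀ n p x, ‖iteratedDeriv n (F p) x‖ ≤ v n p) :
    ContDiff ℝ ∞ (fun x => ∑' p, F p x) ∧
      ∀ n x, iteratedDeriv n (fun x => ∑' p, F p x) x = ∑' p, iteratedDeriv n (F p) x := by
  have h' : ∀ (k p : ℕ) (x : ℝ), (k : ℕ∞) ≤ ⊤ → ‖iteratedFDeriv ℝ k (F p) x‖ ≤ v k p :=
    fun k p x _ => by
      rw [norm_iteratedFDeriv_eq_norm_iteratedDeriv]
      exact h k p x
  refine ⟨contDiff_tsum (N := ⊤) hF (fun k _ => hv k) h', fun n x => ?_⟩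
  have h1 := iteratedFDeriv_tsum (N := ⊤) hF (fun k _ => hv k) h' (k := n) le_top
  have hs : Summable fun p => iteratedFDeriv ℝ n (F p) x :=
    Summable.of_norm_bounded (hv n) fun p => h' n p x le_top
  simp only [iteratedDeriv_eq_iteratedFDeriv, h1]
  exact (ContinuousMultilinearMap.apply ℝ (fun _ : Fin n => ℝ) ℂ (fun _ => 1)).map_tsum hs

section

variable {τ : ℕ → ℝ} {C : ℝ}

/-- Borel's theorem for the weights with quotients `τ`: the dilation parameters `t` control the
size of the derivatives. -/
theorem TailBound.exists_of_jet (h : TailBound τ C) {b : ℕ → ℂ} {t : ℕ → ℝ} {T B₀ : ℝ}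
    (ht : ∀ p : ℕ, 4 * (2 * C + 1) * ((p + 1) / τ p) ≤ t p) (hT : ∀ p, t p ≤ T)
    (hb : ∀ p : ℕ, ‖b p‖ * Real.exp (4 * (2 * C + 1) * (p + 1)) ≤
      B₀ * (t p / 2) ^ p * weight τ p) :
    ∃ f : ℝ → ℂ, ContDiff ℝ ∞ f ∧ tsupport f ⊆ Set.Icc (-1) 1 ∧ (∀ n, iteratedDeriv n f 0 = b n) ∧
      (∃ B, ∀ n x, ‖iteratedDeriv n f x‖ ≤ B * ((2 * T) ^ n * weight τ n)) ∧
      (Tendsto t atTop (𝓝 0) → ∀ δ : ℝ, 0 < δ →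
        ∃ B, ∀ n x, ‖iteratedDeriv n f x‖ ≤ B * (δ ^ n * weight τ n)) := by
  have hC := h.nonneg
  have hτ := h.pos
  have hW := weight_pos hτ
  have htpos : ∀ p, 0 < t p := fun p =>
    lt_of_lt_of_le (by have := hτ p; positivity) (ht p)
  have hT0 : 0 < T := (htpos 0).trans_le (hT 0)
  have hB₀ : 0 ≤ B₀ := by
    have h1 := (by positivity : 0 ≤ ‖b 0‖ * Real.exp (4 * (2 * C + 1) * ((0 : ℕ) + 1))).trans (hb 0)
    simpa [weight] using h1
  choose χ hχ hχ0 hχs hχb hχB using h.exists_unit_jet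
  -- The dilation multiplies the `n`-th derivative by `t p ^ n`, so division by `t p ^ p` restores
  -- the jet. `ht` brings the support into `[-1, 1]`, and `hb` leaves a geometric factor `(1 / 2) ^
  -- p`.
  set F : ℕ → ℝ → ℂ := fun p x => (b p / (t p : ℂ) ^ p) * χ p (t p * x) with hF
  have hFc : ∀ p, ContDiff ℝ ∞ (F p) := fun p =>
    contDiff_const.mul ((hχ p).comp (contDiff_const.mul contDiff_id))
  have hFd : ∀ n p x, iteratedDeriv n (F p) x =
      (b p / (t p : ℂ) ^ p) * (t p ^ n • iteratedDeriv n (χ p) (t p * x)) := by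
    intro n p x
    have h1 := iteratedDeriv_comp_const_smul (n := n)
      ((hχ p).of_le (mod_cast le_top)) (t p)
    simp only [hF]
    rw [iteratedDeriv_const_mul_field, h1]
  have hFn : ∀ n p x, ‖iteratedDeriv n (F p) x‖ =
      ‖b p‖ / t p ^ p * (t p ^ n * ‖iteratedDeriv n (χ p) (t p * x)‖) := by
    intro n p x
    rw [hFd, norm_mul, norm_smul, norm_div, norm_pow, norm_pow, Complex.norm_real,
      Real.norm_eq_abs, abs_of_pos (htpos p)]
  have hFb : ∀ n p x, ‖iteratedDeriv n (F p) x‖ ≤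
      B₀ * (1 / 2) ^ p * ((2 * t p) ^ n * weight τ n) := by
    intro n p x
    have htp := htpos p
    have hWp := hW p
    have hWn := hW n
    rw [hFn]
    calc _ ≤ ‖b p‖ / t p ^ p * (t p ^ n *
          (Real.exp (4 * (2 * C + 1) * (p + 1)) * 2 ^ n * (weight τ n / weight τ p))) := by
          gcongr
          exact hχb p n _
      _ = (‖b p‖ * Real.exp (4 * (2 * C + 1) * (p + 1))) *
          ((2 * t p) ^ n * weight τ n / (t p ^ p * weight τ p)) := by
          rw [mul_pow]; field_simp
      _ ≤ (B₀ * (t p / 2) ^ p * weight τ p) *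
          ((2 * t p) ^ n * weight τ n / (t p ^ p * weight τ p)) :=
          mul_le_mul_of_nonneg_right (hb p) (by positivity)
      _ = _ := by
          generalize (2 * t p) ^ n = q
          rw [div_pow, div_pow]
          field_simp
          simp
  have hgeo : Summable fun p : ℕ => B₀ * (1 / 2 : ℝ) ^ p :=
    (summable_geometric_of_lt_one (by norm_num) (by norm_num)).mul_left _
  have hFv : ∀ n p x, ‖iteratedDeriv n (F p) x‖ ≤
      B₀ * (1 / 2) ^ p * ((2 * T) ^ n * weight τ n) := fun n p x => by
    have htp := htpos p
    have hWn := hW n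
    refine (hFb n p x).trans ?_
    gcongr
    exact hT p
  obtain ⟨hfc, hfd⟩ := iteratedDeriv_tsum hFc (fun n => hgeo.mul_right _) hFv
  have hbound : ∀ (u V : ℕ → ℝ), Summable u → (∀ n p x, ‖iteratedDeriv n (F p) x‖ ≤ u p * V n) →
      ∀ n x, ‖iteratedDeriv n (fun x => ∑' p, F p x) x‖ ≤ (∑' p, u p) * V n := by
    intro u V hu hle n x
    rw [hfd, ← tsum_mul_right]
    exact tsum_of_norm_bounded (hu.mul_right _).hasSum fun p => hle n p x
  refine ⟨fun x => ∑' p, F p x, hfc, ?_, fun n => ?_, ⟨_, hbound _ _ hgeo hFv⟩,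
    fun hlim δ hδ => ?_⟩
  · refine closure_minimal (fun x hx => ?_) isClosed_Icc
    by_contra hx1
    refine hx ?_
    have hx2 : 1 < |x| := by
      by_contra h2
      exact hx1 (abs_le.1 (not_lt.1 h2))
    have h0 : ∀ p, F p x = 0 := fun p => by
      simp only [hF]
      rw [hχs p _ ?_, mul_zero]
      rw [abs_mul, abs_of_pos (htpos p)]
      exact (ht p).trans (le_mul_of_one_le_right (htpos p).le hx2.le)
    simp [h0]
  · rw [hfd, tsum_eq_single n fun p hp => ?_]
    · rw [hFd, mul_zero, hχ0, if_pos rfl]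
      have : (t n : ℂ) ≠ 0 := Complex.ofReal_ne_zero.2 (htpos n).ne'
      rw [Complex.real_smul]
      push_cast
      field_simp
    · rw [hFd, mul_zero, hχ0, if_neg (Ne.symm hp), smul_zero, mul_zero]
  -- For `p ≥ N` the uniform bound has rate `2 * t p ≤ δ`; the finitely many remaining terms use
  -- their own Beurling bounds.
  · obtain ⟨N, hN⟩ := eventually_atTop.1 (hlim.eventually_le_const (half_pos hδ))
    have hex : ∀ p, ∃ B, ∀ n x, ‖iteratedDeriv n (F p) x‖ ≤ B * (δ ^ n * weight τ n) := by
      intro p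
      have htp := htpos p
      obtain ⟨B, hB⟩ := hχB p (δ / t p) (div_pos hδ htp)
      refine ⟨‖b p‖ / t p ^ p * B, fun n x => ?_⟩
      rw [hFn]
      calc _ ≤ ‖b p‖ / t p ^ p * (t p ^ n * (B * ((δ / t p) ^ n * weight τ n))) := by
            gcongr
            exact hB n _
        _ = _ := by rw [div_pow]; field_simp
    choose B hB using hex
    refine ⟨_, hbound (fun p => if p < N then B p else B₀ * (1 / 2) ^ p)
      (fun n => δ ^ n * weight τ n) ?_ fun n p x => ?_⟩
    · rw [← summable_nat_add_iff N]
      simpa using (summable_nat_add_iff N).2 hgeo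
    · split_ifs with hp
      · exact hB p n x
      · refine (hFb n p x).trans ?_
        have htp := htpos p
        have hWn := hW n
        have := hN p (not_lt.1 hp)
        gcongr
        linarith

/-- The terms `1 / τ i` with `p / 2 ≤ i ≤ p` are at least `1 / τ p`, and there are at least `(p + 1)
/ 2` of them. So the quotient is at most twice the tail from `p / 2`. -/
theorem TailBound.tendsto_div (h : TailBound τ C) :
    Tendsto (fun p : ℕ => ((p : ℝ) + 1) / τ p) atTop (𝓝 0) := by
  have hτ := h.pos
  have h0 := tendsto_sum_nat_add fun i => (τ i)⁻¹
  have hdiv : Tendsto (fun p : ℕ => p / 2) atTop atTop :=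
    Nat.tendsto_div_const_atTop two_ne_zero
  have h1 := (h0.comp hdiv).const_mul 2
  rw [mul_zero] at h1
  refine squeeze_zero (fun p => by have := hτ p; positivity) (fun p => ?_) h1
  have hs : Summable fun i => (τ (i + p / 2))⁻¹ := (summable_nat_add_iff _).2 h.summable
  have h2 : ∑ i ∈ Finset.range (p - p / 2 + 1), (τ p)⁻¹ ≤
      ∑ i ∈ Finset.range (p - p / 2 + 1), (τ (i + p / 2))⁻¹ :=
    Finset.sum_le_sum fun i hi => inv_anti₀ (hτ _) (h.mono (by
      have := Finset.mem_range.1 hi; omega))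
  have h3 := hs.sum_le_tsum (Finset.range (p - p / 2 + 1)) fun i _ => (inv_pos.2 (hτ _)).le
  rw [Finset.sum_const, Finset.card_range, nsmul_eq_mul] at h2
  have h4 : (p : ℝ) + 1 ≤ 2 * ((p - p / 2 + 1 : ℕ) : ℝ) := by
    norm_cast
    omega
  have h5 := inv_pos.2 (hτ p)
  calc ((p : ℝ) + 1) / τ p = ((p : ℝ) + 1) * (τ p)⁻¹ := div_eq_mul_inv _ _
    _ ≤ 2 * ((p - p / 2 + 1 : ℕ) : ℝ) * (τ p)⁻¹ := by gcongr
    _ ≤ _ := by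
      simp only [Function.comp_apply]
      linarith

/-- Roumieu version of Borel's theorem. -/
theorem TailBound.exists_roumieu (h : TailBound τ C) {b : ℕ → ℂ} {B₀ H : ℝ} (hH : 0 < H)
    (hb : ∀ p, ‖b p‖ ≤ B₀ * (H ^ p * weight τ p)) :
    ∃ f : ℝ → ℂ, ContDiff ℝ ∞ f ∧ tsupport f ⊆ Set.Icc (-1) 1 ∧ (∀ n, iteratedDeriv n f 0 = b n) ∧
      ∃ T, 0 < T ∧ ∃ B, ∀ n x, ‖iteratedDeriv n f x‖ ≤ B * (T ^ n * weight τ n) := by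
  obtain ⟨D, hD⟩ := h.tendsto_div.bddAbove_range
  have hC := h.nonneg
  set c := 4 * (2 * C + 1) with hc
  have hc0 : 0 < c := by positivity
  -- The first entry meets the support requirement for every `p`; the second absorbs `H ^ p` and the
  -- exponential loss `e ^ (c p)`.
  set T := max (c * D) (2 * H * Real.exp c) with hT
  have hT0 : 0 < T := lt_max_of_lt_right (by positivity)
  obtain ⟨f, hf1, hf2, hf3, ⟨B, hB⟩, -⟩ := h.exists_of_jet (b := b) (t := fun _ => T) (T := T)
    (B₀ := B₀ * Real.exp c) (fun p => le_max_of_le_left (by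
      have := hD ⟨p, rfl⟩
      gcongr)) (fun _ => le_rfl) fun p => by
      have hW := weight_pos h.pos p
      have hB₀ : 0 ≤ B₀ := by
        have h1 := (norm_nonneg _).trans (hb 0)
        simpa [weight] using h1
      have h2 : H * Real.exp c ≤ T / 2 := by
        have := le_max_right (c * D) (2 * H * Real.exp c)
        rw [← hT] at this
        linarith
      calc _ ≤ B₀ * (H ^ p * weight τ p) * Real.exp (c * (p + 1)) := by gcongr; exact hb p
        _ = B₀ * Real.exp c * (H * Real.exp c) ^ p * weight τ p := by
          rw [mul_add, Real.exp_add, mul_comm c, Real.exp_nat_mul, mul_pow, mul_one]; ring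
        _ ≤ _ := by gcongr
  exact ⟨f, hf1, hf2, hf3, 2 * T, by positivity, B, hB⟩

/-- Beurling version of Borel's theorem. -/
theorem TailBound.exists_beurling (h : TailBound τ C) {b : ℕ → ℂ}
    (hb : ∀ δ : ℝ, 0 < δ → ∃ B, ∀ p, ‖b p‖ ≤ B * (δ ^ p * weight τ p)) :
    ∃ f : ℝ → ℂ, ContDiff ℝ ∞ f ∧ tsupport f ⊆ Set.Icc (-1) 1 ∧ (∀ n, iteratedDeriv n f 0 = b n) ∧
      ∀ δ : ℝ, 0 < δ → ∃ B, ∀ n x, ‖iteratedDeriv n f x‖ ≤ B * (δ ^ n * weight τ n) := by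
  have hC := h.nonneg
  have hτ := h.pos
  have hW := weight_pos hτ
  set c := 4 * (2 * C + 1) with hc
  have hc0 : 0 < c := by positivity
  set e : ℕ → ℝ := fun p => (‖b p‖ / weight τ p) ^ (1 / (p : ℝ)) with he
  have he0 : ∀ p, 0 ≤ e p := fun p => Real.rpow_nonneg (div_nonneg (norm_nonneg _) (hW p).le) _
  have hep : ∀ p ≠ 0, e p ^ p = ‖b p‖ / weight τ p := fun p hp => by
    simp only [he, one_div]
    exact Real.rpow_inv_natCast_pow (div_nonneg (norm_nonneg _) (hW p).le) hp
  have helim : Tendsto e atTop (𝓝 0) := by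
    rw [Metric.tendsto_atTop]
    intro ε hε
    obtain ⟨B, hB⟩ := hb (ε / 2) (half_pos hε)
    have h1 : Tendsto (fun p : ℕ => (1 / 2 : ℝ) ^ p * B) atTop (𝓝 (0 * B)) :=
      (tendsto_pow_atTop_nhds_zero_of_lt_one (by norm_num) (by norm_num)).mul_const B
    rw [zero_mul] at h1
    obtain ⟨N, hN⟩ := eventually_atTop.1 (h1.eventually_lt_const one_pos)
    refine ⟨N + 1, fun p hp => ?_⟩
    rw [Real.dist_eq, sub_zero, abs_of_nonneg (he0 p)]
    refine lt_of_pow_lt_pow_left₀ p hε.le ?_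
    rw [hep p (by omega), div_lt_iff₀ (hW p)]
    calc ‖b p‖ ≤ B * ((ε / 2) ^ p * weight τ p) := hB p
      _ = ((1 / 2) ^ p * B) * (ε ^ p * weight τ p) := by rw [div_pow, div_pow]; ring
      _ < 1 * (ε ^ p * weight τ p) :=
        mul_lt_mul_of_pos_right (hN p (by omega)) (mul_pos (pow_pos hε p) (hW p))
      _ = _ := one_mul _
  -- The first summand meets the support requirement, the second absorbs `‖b p‖` and `e ^ (c p)`;
  -- both tend to `0`.
  set t : ℕ → ℝ := fun p => c * ((p + 1) / τ p) + 2 * Real.exp c * e p with ht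
  have htlim : Tendsto t atTop (𝓝 0) := by
    simpa using (h.tendsto_div.const_mul c).add (helim.const_mul (2 * Real.exp c))
  obtain ⟨T, hT⟩ := htlim.bddAbove_range
  have hq : ∀ p : ℕ, 0 ≤ c * (((p : ℝ) + 1) / τ p) := fun p => by have := hτ p; positivity
  obtain ⟨f, hf1, hf2, hf3, -, hf4⟩ := h.exists_of_jet (b := b) (t := t) (T := T)
    (B₀ := Real.exp c * (1 + ‖b 0‖)) (fun p => by
      have := he0 p
      simp only [ht]
      rw [← hc, le_add_iff_nonneg_right]
      positivity) (fun p => hT ⟨p, rfl⟩) fun p => by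
      rw [← hc]
      -- At `p = 0` the exponent `1 / p` is `0`, so `e 0` says nothing about `b 0`; the factor `1 +
      -- ‖b 0‖` in `B₀` covers this index.
      rcases eq_or_ne p 0 with rfl | hp
      · have := norm_nonneg (b 0)
        have := Real.exp_pos c
        simp only [weight, Finset.range_zero, Finset.prod_empty, pow_zero, Nat.cast_zero, zero_add,
          mul_one]
        nlinarith
      · have h1 : Real.exp c * e p ≤ t p / 2 := by
          simp only [ht]
          linarith [hq p]
        have h2 := he0 p
        have h3 := hW p
        calc _ = Real.exp c * (Real.exp c * e p) ^ p * weight τ p := by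
              rw [mul_add, Real.exp_add, mul_comm c, Real.exp_nat_mul, mul_pow, mul_one, hep p hp]
              field_simp
          _ ≤ Real.exp c * (t p / 2) ^ p * weight τ p := by gcongr
          _ ≤ _ := by
            have h4 : 0 ≤ t p / 2 := (by positivity : 0 ≤ Real.exp c * e p).trans h1
            gcongr
            exact le_mul_of_one_le_right (Real.exp_pos c).le (by simp)
  exact ⟨f, hf1, hf2, hf3, hf4 htlim⟩

end

/-! ### Bang's quantitative form of the Denjoy–Carleman theorem -/

section

variable {F : ℕ → ℝ → ℂ} {σ : ℕ → ℝ} {A : ℝ}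

/-- Descending induction on the order `j`, starting from `n`: as `σ j ≤ s`, the bound for `F (j +
1)` is at most the derivative of the bound for `F j`, so a comparison starting at `x` applies. -/
theorem IsDerivChain.norm_le_exp (hF : IsDerivChain F) (hA : 0 ≤ A) (hσ : ∀ i, 0 < σ i)
    {s x y κ : ℝ} {n : ℕ} (hs0 : 0 ≤ s) (hs : ∀ j < n, σ j ≤ s)
    (hn : ∀ z ∈ Set.Icc x y, ‖F n z‖ ≤ A * Real.exp (n - κ) * weight σ n)
    (hx : ∀ j, ‖F j x‖ ≤ A * Real.exp (j - κ) * weight σ j) {i j : ℕ} (hij : j + i = n) :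
    ∀ z ∈ Set.Icc x y,
      ‖F j z‖ ≤ A * Real.exp (j - κ) * weight σ j * Real.exp (Real.exp 1 * s * (z - x)) := by
  induction i generalizing j with
  | zero =>
    intro z hz
    obtain rfl : j = n := by omega
    refine (hn z hz).trans (le_mul_of_one_le_right ?_ (Real.one_le_exp ?_))
    · have := weight_pos hσ j; positivity
    · have : 0 ≤ z - x := by linarith [hz.1]
      positivity
  | succ i ih =>
    intro z hz
    have ih' := ih (j := j + 1) (by omega)
    have hW := weight_pos hσ j
    refine image_norm_le_of_norm_deriv_right_le_deriv_boundary (f := F j) (f' := F (j + 1))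
      (fun u _ => (hF j u).continuousAt.continuousWithinAt)
      (fun u _ => (hF j u).hasDerivWithinAt)
      (B := fun z => A * Real.exp (j - κ) * weight σ j * Real.exp (Real.exp 1 * s * (z - x)))
      (B' := fun z => A * Real.exp (j - κ) * weight σ j *
        (Real.exp (Real.exp 1 * s * (z - x)) * (Real.exp 1 * s))) ?_ (fun u => ?_) (fun u hu => ?_) hz
    · simpa using hx j
    · refine HasDerivAt.const_mul _ (HasDerivAt.exp ?_)
      simpa using ((hasDerivAt_id u).sub_const x).const_mul (Real.exp 1 * s)
    · refine (ih' u (Set.Ico_subset_Icc_self hu)).trans ?_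
      rw [weight_succ]
      have h1 := hs j (by omega)
      have h2 : Real.exp ((j + 1 : ℕ) - κ) = Real.exp (j - κ) * Real.exp 1 := by
        rw [← Real.exp_add]; push_cast; ring_nf
      rw [h2]
      calc _ = A * Real.exp (j - κ) * weight σ j *
            (Real.exp (Real.exp 1 * s * (u - x)) * (Real.exp 1 * σ j)) := by ring
        _ ≤ _ := by gcongr

/-- A function which is flat at `0` stays small for a distance controlled by the sum of the
inverse quotients of its bounds. -/
theorem IsDerivChain.norm_le_of_flat (hF : IsDerivChain F) (hA : 0 ≤ A) (hσ : ∀ i, 0 < σ i)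
    (hm : Monotone σ) (hflat : ∀ j, F j 0 = 0) {x₀ : ℝ}
    (hb : ∀ j, ∀ x ∈ Set.Icc 0 x₀, ‖F j x‖ ≤ A * weight σ j) (i k : ℕ) {x : ℝ}
    (hx : x ∈ Set.Icc 0 x₀) (hxs : x ≤ ∑ j ∈ Finset.range i, (Real.exp 1 * σ (k + j))⁻¹) (j : ℕ) :
    ‖F j x‖ ≤ A * Real.exp (j - k) * weight σ j := by
  induction i generalizing k x j with
  | zero =>
    have hx0 : x = 0 := le_antisymm (by simpa using hxs) hx.1
    have := weight_pos hσ j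
    rw [hx0, hflat, norm_zero]
    positivity
  | succ i ih =>
    have hW := weight_pos hσ j
    rcases le_or_gt k j with hj | hj
    · refine (hb j x hx).trans ?_
      have h1 : 1 ≤ Real.exp ((j : ℝ) - k) :=
        Real.one_le_exp (sub_nonneg.2 (by exact_mod_cast hj))
      calc A * weight σ j ≤ A * weight σ j * Real.exp ((j : ℝ) - k) :=
            le_mul_of_one_le_right (by positivity) h1
        _ = _ := by ring
    · have hsk := hσ k
      -- One step back by `d`, the induction hypothesis holds with `k + 1` in place of `k`. Moving
      -- forward again costs at most a factor `e`, exactly the difference between the two bounds.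
      set d := (Real.exp 1 * σ k)⁻¹ with hd
      have hd0 : 0 < d := by positivity
      set x' := max 0 (x - d) with hx'
      have hx'x : x' ≤ x := max_le hx.1 (by linarith)
      have hmem : x' ∈ Set.Icc 0 x₀ := ⟨le_max_left _ _, hx'x.trans hx.2⟩
      have h1 : x' ≤ ∑ j ∈ Finset.range i, (Real.exp 1 * σ (k + 1 + j))⁻¹ := by
        refine max_le (Finset.sum_nonneg fun j _ => ?_) ?_
        · have := hσ (k + 1 + j); positivity
        · rw [Finset.sum_range_succ', add_zero, ← hd] at hxs
          have h3 : ∀ j, k + 1 + j = k + (j + 1) := fun j => by ring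
          simp only [h3]
          linarith
      have h2 := fun j => ih (k + 1) hmem h1 j
      have h3 := hF.norm_le_exp (n := k + 1) (y := x) (i := k + 1 - j) (j := j) hA hσ hsk.le
        (fun j hj => hm (by omega)) (fun z hz => by
          simpa using hb (k + 1) z ⟨hmem.1.trans hz.1, hz.2.trans hx.2⟩) h2 (by omega) x
        ⟨hx'x, le_rfl⟩
      refine h3.trans ?_
      have h4 : Real.exp 1 * σ k * (x - x') ≤ 1 := by
        have h5 : x - x' ≤ d := by linarith [le_max_right 0 (x - d)]
        calc _ ≤ Real.exp 1 * σ k * d := by gcongr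
          _ = 1 := by rw [hd]; field_simp
      calc _ ≤ A * Real.exp (j - (k + 1 : ℕ)) * weight σ j * Real.exp 1 := by gcongr
        _ = A * (Real.exp (j - (k + 1 : ℕ)) * Real.exp 1) * weight σ j := by ring
        _ = _ := by
          rw [← Real.exp_add]; push_cast; ring_nf

end

/-! ### From unit jets to tail sums -/

section

variable {τ : ℕ → ℝ}

/-- A function whose jet at `0` has a single nonzero entry, with good bounds, forces the convergence
of `∑ 1 / τ i` with an estimate of its tail. -/
theorem IsDerivChain.sum_inv_le {G : ℕ → ℝ → ℂ} (hG : IsDerivChain G) (hτ : ∀ i, 0 < τ i)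
    (hm : Monotone τ) {H L : ℝ} (hH : 1 ≤ H) (hL : 1 ≤ L) {Q N : ℕ} (hQ : 1 ≤ Q)
    (hN : 2 * H * L + 1 ≤ N)
    (hjet : ∀ m, G m 0 = if m = 2 * Q then 1 else 0)
    (hb : ∀ m x, ‖G m x‖ ≤ L ^ Q * H ^ m * (weight τ m / weight τ (2 * Q))) (i : ℕ) :
    ∑ j ∈ Finset.range i, (τ ((N + 1) * Q + j))⁻¹ ≤
      Real.exp 1 * H * (2 * H * L) * (Q / τ Q) := by
  set K := 2 * H * L with hK
  have hHL : 1 ≤ H * L := one_le_mul_of_one_le_of_one_le hH hL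
  have hK2 : 2 ≤ K := by rw [hK]; nlinarith
  set s := τ Q with hs
  have hs0 : 0 < s := hτ Q
  have hH0 : 0 < H := by linarith
  have hL0 : 0 < L := by linarith
  have hW := weight_pos hτ
  have hQ1 : (1 : ℝ) ≤ Q := by exact_mod_cast hQ
  -- The first `Q` quotients are frozen so that one weight controls both the derivatives of `x^Q/Q!`
  -- and those of `G Q`; from index `Q` on they are the shifted quotients of `τ`.
  set σ : ℕ → ℝ := fun m => if m < Q then H * s else H * τ (Q + m) with hσdef
  have hσ : ∀ m, 0 < σ m := fun m => by
    simp only [hσdef]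
    have := hτ (Q + m)
    split_ifs <;> positivity
  have hσm : Monotone σ := by
    intro a b hab
    simp only [hσdef]
    split_ifs with h1 h2
    · exact le_rfl
    · exact mul_le_mul_of_nonneg_left (hm (by omega)) hH0.le
    · omega
    · exact mul_le_mul_of_nonneg_left (hm (by omega)) hH0.le
  have hWlow : ∀ m ≤ Q, weight σ m = (H * s) ^ m := fun m hmQ => by
    rw [weight, Finset.prod_congr rfl (g := fun _ => H * s) fun i hi => by
      have := Finset.mem_range.1 hi
      simp only [hσdef]
      rw [if_pos (by omega)]]
    simp
  have hWcmp : ∀ m, weight τ (Q + m) * H ^ m * s ^ Q ≤ weight τ (2 * Q) * weight σ m := by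
    have hlow : ∀ m ≤ Q, weight τ (Q + m) * H ^ m * s ^ Q ≤ weight τ (2 * Q) * weight σ m := by
      intro m hmQ
      obtain ⟨k, rfl⟩ := Nat.exists_eq_add_of_le hmQ
      have h1 := weight_mul_pow_le hτ hm (n := 2 * (m + k)) (k := k) (s := s) (by omega) hs0.le
        (hm (by omega))
      rw [show 2 * (m + k) - k = m + k + m by omega] at h1
      rw [hWlow m hmQ, mul_pow]
      calc _ = (weight τ (m + k + m) * s ^ k) * (H ^ m * s ^ m) := by ring
        _ ≤ _ := by gcongr
    intro m
    rcases le_total m Q with h | h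
    · exact hlow m h
    · induction m, h using Nat.le_induction with
      | base => exact hlow Q le_rfl
      | succ m hmQ ih =>
        rw [weight_succ σ, show Q + (m + 1) = Q + m + 1 by ring, weight_succ τ]
        have h1 : σ m = H * τ (Q + m) := by
          simp only [hσdef]
          rw [if_neg (by omega)]
        rw [h1]
        have := hτ (Q + m)
        calc _ = (weight τ (Q + m) * H ^ m * s ^ Q) * (H * τ (Q + m)) := by ring
          _ ≤ (weight τ (2 * Q) * weight σ m) * (H * τ (Q + m)) := by gcongr
          _ = _ := by ring
  have hGb : ∀ m x, ‖G (Q + m) x‖ ≤ (K / 2) ^ Q / s ^ Q * weight σ m := by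
    intro m x
    have h2 := hW (2 * Q)
    calc _ ≤ L ^ Q * H ^ (Q + m) * (weight τ (Q + m) / weight τ (2 * Q)) := hb _ x
      _ = (L * H) ^ Q / (s ^ Q * weight τ (2 * Q)) * (weight τ (Q + m) * H ^ m * s ^ Q) := by
        rw [mul_pow, pow_add]; field_simp
      _ ≤ (L * H) ^ Q / (s ^ Q * weight τ (2 * Q)) * (weight τ (2 * Q) * weight σ m) :=
        mul_le_mul_of_nonneg_left (hWcmp m) (by positivity)
      _ = _ := by
        rw [show K / 2 = L * H by rw [hK]; ring]; field_simp
  -- At this point `x^Q/Q!` is at least `K^Q/s^Q`, because `Q! ≤ Q^Q`, whereas `G Q` is at most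
  -- `(K/2)^Q/s^Q`; the difference cannot be small.
  set x₀ := K * Q / s with hx₀
  have hx₀0 : 0 ≤ x₀ := by positivity
  set E := Real.exp (K * Q) with hE
  have hKE : K ^ Q ≤ E := by
    rw [hE, mul_comm, Real.exp_nat_mul]
    gcongr
    linarith [Real.add_one_le_exp K]
  set F : ℕ → ℝ → ℂ := fun m x => G (Q + m) x - monomialDeriv Q m x with hFdef
  have hF : IsDerivChain F := fun m x => (hG (Q + m) x).sub (isDerivChain_monomialDeriv Q m x)
  have hflat : ∀ m, F m 0 = 0 := fun m => by
    simp only [hFdef]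
    rw [hjet, monomialDeriv_zero_right]
    by_cases h : m = Q
    · rw [if_pos (by omega), if_pos h, sub_self]
    · rw [if_neg (by omega), if_neg h, sub_self]
  have hK2Q : (K / 2) ^ Q ≤ K ^ Q / 2 := by
    rw [div_pow]
    gcongr
    exact le_self_pow₀ (by norm_num) (by omega)
  have hFb : ∀ m, ∀ x ∈ Set.Icc 0 x₀, ‖F m x‖ ≤ 2 * E / s ^ Q * weight σ m := by
    intro m x hx
    have hWσ := weight_pos hσ m
    have h1 : ‖monomialDeriv Q m x‖ ≤ E / s ^ Q * weight σ m := by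
      rcases le_or_gt m Q with h | h
      · have h2 := norm_monomialDeriv_le (p := Q) (k := m) (x := x) (y := K * Q) hs0 (by positivity)
          (by rw [abs_of_nonneg hx.1]; exact hx.2)
        refine h2.trans ?_
        rw [hWlow m h, mul_pow]
        calc E * s ^ m / s ^ Q = E / s ^ Q * (1 * s ^ m) := by ring
          _ ≤ _ := by gcongr; exact one_le_pow₀ hH
      · rw [monomialDeriv, if_neg (by omega), norm_zero]
        positivity
    have h3 : (K / 2) ^ Q ≤ E := by
      have : 0 ≤ K ^ Q := by positivity
      linarith
    calc ‖F m x‖ ≤ ‖G (Q + m) x‖ + ‖monomialDeriv Q m x‖ := norm_sub_le _ _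
      _ ≤ (K / 2) ^ Q / s ^ Q * weight σ m + E / s ^ Q * weight σ m := add_le_add (hGb m x) h1
      _ ≤ E / s ^ Q * weight σ m + E / s ^ Q * weight σ m := by gcongr
      _ = _ := by ring
  have hlarge : (s ^ Q)⁻¹ ≤ ‖F 0 x₀‖ := by
    have h1 : K ^ Q / s ^ Q ≤ ‖monomialDeriv Q 0 x₀‖ := by
      rw [monomialDeriv, if_pos (Nat.zero_le _), Nat.sub_zero, Complex.norm_real, Real.norm_eq_abs,
        abs_of_nonneg (by positivity), hx₀, div_pow, mul_pow K, le_div_iff₀ (by positivity)]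
      have h2 : (Q ! : ℝ) ≤ (Q : ℝ) ^ Q := by exact_mod_cast Nat.factorial_le_pow Q
      calc K ^ Q / s ^ Q * (Q ! : ℝ) ≤ K ^ Q / s ^ Q * (Q : ℝ) ^ Q := by gcongr
        _ = _ := by ring
    have h2 := hGb 0 x₀
    have h3 : weight σ 0 = 1 := by simp [weight]
    rw [h3, mul_one, add_zero] at h2
    have h4 : ‖F 0 x₀‖ = ‖monomialDeriv Q 0 x₀ - G Q x₀‖ := by
      simp only [hFdef, add_zero]
      exact norm_sub_rev _ _
    rw [h4]
    refine le_trans ?_ (norm_sub_norm_le _ _)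
    have h5 : (2 : ℝ) ≤ K ^ Q := hK2.trans (le_self_pow₀ (by linarith) (by omega))
    calc (s ^ Q)⁻¹ = 1 / s ^ Q := (one_div _).symm
      _ ≤ (K ^ Q - (K / 2) ^ Q) / s ^ Q := by gcongr; linarith
      _ = K ^ Q / s ^ Q - (K / 2) ^ Q / s ^ Q := sub_div _ _ _
      _ ≤ _ := by linarith
  -- Otherwise flatness, started at level `N * Q`, would bound `F 0 x₀` by `2 s^{-Q} e^{KQ - NQ}`.
  -- As `N ≥ K + 1`, this is at most `2 s^{-Q} / e < s^{-Q}`, contradicting `hlarge`.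
  have hlt : ∑ j ∈ Finset.range i, (Real.exp 1 * σ (N * Q + j))⁻¹ < x₀ := by
    by_contra hcon
    have h1 := hF.norm_le_of_flat (by positivity) hσ hσm hflat hFb i (N * Q) ⟨hx₀0, le_rfl⟩
      (not_lt.1 hcon) 0
    have h3 : weight σ 0 = 1 := by simp [weight]
    rw [h3, mul_one] at h1
    have h2 : E * Real.exp ((0 : ℕ) - (N * Q : ℕ)) ≤ Real.exp (-1) := by
      rw [hE, ← Real.exp_add, Real.exp_le_exp]
      push_cast
      nlinarith
    have h4 : Real.exp (-1) < 1 / 2 := by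
      rw [Real.exp_neg, one_div]
      exact inv_strictAnti₀ two_pos (by linarith [Real.exp_one_gt_d9])
    have h5 : 0 < (s ^ Q)⁻¹ := by positivity
    have h6 : 2 * E / s ^ Q * Real.exp ((0 : ℕ) - (N * Q : ℕ)) =
        2 * (s ^ Q)⁻¹ * (E * Real.exp ((0 : ℕ) - (N * Q : ℕ))) := by ring
    rw [h6] at h1
    have h8 := mul_lt_mul_of_pos_left (h2.trans_lt h4) h5
    linarith
  have hN1 : 1 ≤ N := by
    have : (1 : ℝ) ≤ N := by linarith
    exact_mod_cast this
  have hσN : ∀ j, σ (N * Q + j) = H * τ ((N + 1) * Q + j) := fun j => by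
    simp only [hσdef]
    rw [if_neg (by nlinarith)]
    congr 2
    ring
  have h7 : ∑ j ∈ Finset.range i, (τ ((N + 1) * Q + j))⁻¹ =
      Real.exp 1 * H * ∑ j ∈ Finset.range i, (Real.exp 1 * σ (N * Q + j))⁻¹ := by
    rw [Finset.mul_sum]
    refine Finset.sum_congr rfl fun j _ => ?_
    rw [hσN]
    field_simp
  rw [h7]
  calc _ ≤ Real.exp 1 * H * x₀ := by gcongr
    _ = _ := by rw [hx₀]; ring

end

/-! ### Quadratic Taylor remainders -/

section

variable {F : ℕ → ℝ → ℂ}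

/-- The sharp factor `1 / 2` is not needed. The estimate serves twice: for the Landau inequality,
and to express the derivative relation by inequalities that survive pointwise limits. -/
theorem IsDerivChain.norm_taylor_le (hF : IsDerivChain F) {m : ℕ} {B : ℝ}
    (hB : ∀ x, ‖F (m + 2) x‖ ≤ B) (x y : ℝ) :
    ‖F m y - F m x - (y - x) • F (m + 1) x‖ ≤ B * |y - x| ^ 2 := by
  have hB0 : 0 ≤ B := (norm_nonneg _).trans (hB 0)
  have h1 : ∀ z, ‖F (m + 1) z - F (m + 1) x‖ ≤ B * ‖z - x‖ := fun z =>
    convex_univ.norm_image_sub_le_of_norm_hasDerivWithin_le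
      (fun u _ => (hF (m + 1) u).hasDerivWithinAt) (fun u _ => hB u) (Set.mem_univ _)
      (Set.mem_univ _)
  have h2 : ∀ z, HasDerivAt (fun z => F m z - (z - x) • F (m + 1) x)
      (F (m + 1) z - F (m + 1) x) z := fun z => by
    refine (hF m z).sub ?_
    simpa using ((hasDerivAt_id z).sub_const x).smul_const (F (m + 1) x)
  have h3 := (convex_uIcc x y).norm_image_sub_le_of_norm_hasDerivWithin_le
    (C := B * |y - x|) (fun z _ => (h2 z).hasDerivWithinAt) (fun z hz => by
      refine (h1 z).trans (mul_le_mul_of_nonneg_left ?_ hB0)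
      exact Set.abs_sub_left_of_mem_uIcc hz) Set.left_mem_uIcc Set.right_mem_uIcc
  calc _ = ‖F m y - (y - x) • F (m + 1) x - (F m x - (x - x) • F (m + 1) x)‖ := by
        congr 1
        rw [sub_self, zero_smul]
        abel
    _ ≤ _ := h3
    _ = _ := by rw [Real.norm_eq_abs]; ring

theorem hasDerivAt_of_norm_sub_le {g : ℝ → ℂ} {g' : ℂ} {B x : ℝ}
    (h : ∀ y, ‖g y - g x - (y - x) • g'‖ ≤ B * |y - x| ^ 2) : HasDerivAt g g' x := by
  rw [hasDerivAt_iff_isLittleO]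
  refine Asymptotics.IsBigO.trans_isLittleO (g := fun y => ‖y - x‖ ^ 2)
    (Asymptotics.IsBigO.of_bound B (Eventually.of_forall fun y => ?_))
    (Asymptotics.isLittleO_pow_sub_sub x one_lt_two)
  simpa using h y

/-! ### A Landau–Kolmogorov inequality -/

/-- Maximum principle for log-convex sequences, with zeros allowed: at the smallest index of the
maximum the left neighbour is strictly smaller, which contradicts the inequality if that index is
interior. -/
theorem le_max_of_sq_le_mul {c : ℕ → ℝ} {r : ℕ} (hc : ∀ j, 0 ≤ c j)
    (h : ∀ j, j + 2 ≤ r → c (j + 1) ^ 2 ≤ c j * c (j + 2)) {j : ℕ} (hj : j ≤ r) :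
    c j ≤ max (c 0) (c r) := by
  by_contra! hcon
  obtain ⟨i, hi, himax⟩ := Finset.exists_max_image (Finset.range (r + 1)) c ⟨0, by simp⟩
  have hex : ∃ i, i ≤ r ∧ ∀ k ≤ r, c k ≤ c i :=
    ⟨i, by have := Finset.mem_range.1 hi; omega, fun k hk => himax k (Finset.mem_range.2 (by omega))⟩
  classical
  obtain ⟨h1, h2⟩ := Nat.find_spec hex
  have h3 := fun {k} (hk : k < Nat.find hex) => Nat.find_min hex hk
  generalize Nat.find hex = i at h1 h2 h3
  have h4 := hcon.trans_le (h2 j hj)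
  have h5 : i ≠ 0 := by
    rintro rfl
    exact absurd h4 (not_lt.2 (le_max_left _ _))
  have h6 : i ≠ r := by
    rintro rfl
    exact absurd h4 (not_lt.2 (le_max_right _ _))
  obtain ⟨i, rfl⟩ := Nat.exists_eq_succ_of_ne_zero h5
  have h7 := h i (by omega)
  have h8 := h2 (i + 2) (by omega)
  have h9 : c i < c (i + 1) := by
    by_contra! h10
    exact h3 (Nat.lt_succ_self i) ⟨by omega, fun k hk => (h2 k hk).trans h10⟩
  have h10 := hc i
  simp only [Nat.succ_eq_add_one] at *
  nlinarith

theorem IsDerivChain.norm_le_of_norm_le (hF : IsDerivChain F) (hbdd : ∀ m, ∃ B, ∀ x, ‖F m x‖ ≤ B)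
    {r j : ℕ} (hj : j ≤ r) {B s : ℝ} (hs : 0 < s) (h0 : ∀ x, ‖F 0 x‖ ≤ B)
    (hr : ∀ x, ‖F r x‖ ≤ B * s ^ r) (x : ℝ) : ‖F j x‖ ≤ 3 ^ r ^ 2 * B * s ^ j := by
  have hB : 0 ≤ B := (norm_nonneg _).trans (h0 0)
  set N : ℕ → ℝ := fun m => ⨆ x, ‖F m x‖ with hN
  have hle : ∀ m x, ‖F m x‖ ≤ N m := fun m x => by
    obtain ⟨B, hB⟩ := hbdd m
    exact le_ciSup (f := fun x => ‖F m x‖) ⟨B, by rintro _ ⟨x, rfl⟩; exact hB x⟩ x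
  have hN0 : ∀ m, 0 ≤ N m := fun m => (norm_nonneg _).trans (hle m 0)
  have hstep : ∀ m, N (m + 1) ^ 2 ≤ 9 * (N m * N (m + 2)) := by
    intro m
    -- Taylor's formula with every step `δ > 0`; the discriminant then optimises over `δ`, giving
    -- the constant `8 ≤ 9`.
    have h1 : ∀ δ : ℝ, 0 ≤ N (m + 2) * (δ * δ) + (-N (m + 1)) * δ + 2 * N m := by
      intro δ
      rcases le_or_gt δ 0 with hδ | hδ
      · have := mul_nonneg (hN0 (m + 2)) (mul_self_nonneg δ)
        have := mul_nonneg (hN0 (m + 1)) (neg_nonneg.2 hδ)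
        have := hN0 m
        linarith
      · have h2 : N (m + 1) ≤ (2 * N m + N (m + 2) * δ ^ 2) / δ := by
          refine ciSup_le fun x => ?_
          rw [le_div_iff₀ hδ]
          have h3 := hF.norm_taylor_le (hle (m + 2)) x (x + δ)
          rw [add_sub_cancel_left, abs_of_pos hδ] at h3
          have h4 : δ * ‖F (m + 1) x‖ = ‖δ • F (m + 1) x‖ := by
            rw [norm_smul, Real.norm_eq_abs, abs_of_pos hδ]
          have h5 : δ • F (m + 1) x = F m (x + δ) - F m x -
            (F m (x + δ) - F m x - δ • F (m + 1) x) := by abel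
          rw [mul_comm, h4, h5]
          refine (norm_sub_le _ _).trans ?_
          have h6 := norm_sub_le (F m (x + δ)) (F m x)
          linarith [hle m (x + δ), hle m x]
        rw [le_div_iff₀ hδ] at h2
        linarith
    have h2 := discrim_le_zero h1
    rw [discrim] at h2
    have := mul_nonneg (hN0 m) (hN0 (m + 2))
    linarith
  -- The second difference of `j ^ 2` is `2`, so the weight `3 ^ j ^ 2` absorbs the factor `9` and
  -- makes the sequence log-convex.
  have h1 := le_max_of_sq_le_mul (c := fun j => 3 ^ j ^ 2 * (N j / s ^ j)) (r := r)
    (fun j => by have := hN0 j; positivity) (fun j _ => by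
      have h1 := hstep j
      calc (3 ^ (j + 1) ^ 2 * (N (j + 1) / s ^ (j + 1))) ^ 2
          = (3 ^ (j + 1) ^ 2 / s ^ (j + 1)) ^ 2 * N (j + 1) ^ 2 := by ring
        _ ≤ (3 ^ (j + 1) ^ 2 / s ^ (j + 1)) ^ 2 * (9 * (N j * N (j + 2))) := by gcongr
        _ = _ := by
          have e1 : (3 : ℝ) ^ (j + 2) ^ 2 = 3 ^ j ^ 2 * (3 ^ j) ^ 4 * 81 := by ring
          have e2 : (3 : ℝ) ^ (j + 1) ^ 2 = 3 ^ j ^ 2 * (3 ^ j) ^ 2 * 3 := by ring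
          rw [e1, e2]
          field_simp
          ring) hj
  have h2 : 3 ^ j ^ 2 * (N j / s ^ j) ≤ 3 ^ r ^ 2 * B := by
    refine h1.trans (max_le ?_ ?_)
    · have h2 : N 0 ≤ B := ciSup_le h0
      have h3 : (1 : ℝ) ≤ 3 ^ r ^ 2 := one_le_pow₀ (by norm_num)
      simp only [ne_eq, OfNat.ofNat_ne_zero, not_false_eq_true, zero_pow, pow_zero, div_one, one_mul]
      nlinarith
    · have h2 : N r ≤ B * s ^ r := ciSup_le hr
      gcongr
      rwa [div_le_iff₀ (pow_pos hs r)]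
  have h3 : N j / s ^ j ≤ 3 ^ r ^ 2 * B := by
    refine le_trans (le_mul_of_one_le_left ?_ (one_le_pow₀ (by norm_num))) h2
    have := hN0 j
    positivity
  rw [div_le_iff₀ (pow_pos hs j)] at h3
  exact (hle j x).trans h3

end

/-! ### Compactness and Baire's theorem -/

/-- The sequences satisfying the bounds `B`, each function being the derivative of its
predecessor. -/
def boundedChains (B : ℕ → ℝ) : Set (ℕ → ℝ → ℂ) :=
  {G | (∀ m x, ‖G m x‖ ≤ B m) ∧
    ∀ m x y, ‖G m y - G m x - (y - x) • G (m + 1) x‖ ≤ B (m + 2) * |y - x| ^ 2}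

theorem mem_boundedChains_iff {B : ℕ → ℝ} {G : ℕ → ℝ → ℂ} :
    G ∈ boundedChains B ↔ IsDerivChain G ∧ ∀ m x, ‖G m x‖ ≤ B m :=
  ⟨fun h => ⟨fun m x => hasDerivAt_of_norm_sub_le (h.2 m x), h.1⟩,
    fun h => ⟨h.2, fun m => h.1.norm_taylor_le (h.2 (m + 2))⟩⟩

/-- Tychonoff's theorem in the topology of pointwise convergence: every defining inequality involves
finitely many evaluations, so the set is closed in a product of discs. -/
theorem isCompact_boundedChains (B : ℕ → ℝ) : IsCompact (boundedChains B) := by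
  have h1 : IsCompact (Set.univ.pi fun m : ℕ => Set.univ.pi fun _ : ℝ =>
      Metric.closedBall (0 : ℂ) (B m)) :=
    isCompact_univ_pi fun m => isCompact_univ_pi fun _ => isCompact_closedBall _ _
  have hev : ∀ (m : ℕ) (x : ℝ), Continuous fun G : ℕ → ℝ → ℂ => G m x := fun m x =>
    (continuous_apply x).comp (continuous_apply m)
  refine h1.of_isClosed_subset ?_ fun G hG m _ x _ => by simpa using hG.1 m x
  simp only [boundedChains, Set.ofPred_and, Set.ofPred_forall]
  refine IsClosed.inter ?_ ?_
  · exact isClosed_iInter fun m => isClosed_iInter fun x =>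
      isClosed_le (hev m x).norm continuous_const
  · exact isClosed_iInter fun m => isClosed_iInter fun x => isClosed_iInter fun y =>
      isClosed_le (((hev m y).sub (hev m x)).sub ((hev (m + 1) x).const_smul (y - x))).norm
        continuous_const

/-- If all the jets with entries in `{0, v i}` are attained by smooth functions, then the jets with
a single nonzero entry `v i` are attained with uniform bounds. -/
theorem exists_uniform_bound {v : ℕ → ℂ} {B : ℕ → ℕ → ℝ}
    (h : ∀ x : ℕ → Bool, ∃ n, ∃ G, IsDerivChain G ∧ (∀ m y, ‖G m y‖ ≤ B n m) ∧
      ∀ i, G i 0 = if x i then v i else 0) :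
    ∃ n k : ℕ, ∀ i ≥ k, ∃ G, IsDerivChain G ∧ (∀ m y, ‖G m y‖ ≤ 2 * B n m) ∧
      ∀ j, G j 0 = if j = i then v i else 0 := by
  set J : (ℕ → ℝ → ℂ) → ℕ → ℂ := fun G i => G i 0 with hJ
  have hJc : Continuous J := continuous_pi fun i => (continuous_apply 0).comp (continuous_apply i)
  set e : (ℕ → Bool) → ℕ → ℂ := fun x i => if x i then v i else 0 with he
  have hec : Continuous e := continuous_pi fun i =>
    (continuous_of_discreteTopology (f := fun b : Bool => if b then v i else 0)).comp
      (continuous_apply i)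
  set E : ℕ → Set (ℕ → Bool) := fun n => e ⁻¹' (J '' boundedChains (B n)) with hE
  have hEc : ∀ n, IsClosed (E n) := fun n =>
    ((isCompact_boundedChains (B n)).image hJc).isClosed.preimage hec
  have hEu : ⋃ n, E n = Set.univ := by
    refine Set.eq_univ_of_forall fun x => Set.mem_iUnion.2 ?_
    obtain ⟨n, G, hG, hGB, hGj⟩ := h x
    exact ⟨n, G, mem_boundedChains_iff.2 ⟨hG, hGB⟩, funext hGj⟩
  obtain ⟨n, x, hx⟩ := nonempty_interior_of_iUnion_of_closed hEc hEu
  obtain ⟨I, u, hu, huE⟩ := isOpen_pi_iff.1 isOpen_interior x hx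
  obtain ⟨k, hk⟩ := I.bddAbove
  refine ⟨n, k + 1, fun i hi => ?_⟩
  have hiI : i ∉ I := fun h => by
    have := hk h
    omega
  -- The open set given by Baire's theorem restricts only the coordinates in `I`, so coordinate `i`
  -- is free; subtracting the two realisations isolates the entry `v i` and doubles the bound.
  have hup : ∀ b : Bool, Function.update x i b ∈ E n := fun b => by
    refine interior_subset (huE fun j hj => ?_)
    have hji : j ≠ i := fun hji => hiI (hji ▸ Finset.mem_coe.1 hj)
    rw [Function.update_of_ne hji]
    exact (hu j hj).2
  obtain ⟨G, hG, hGj⟩ := hup true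
  obtain ⟨G', hG', hGj'⟩ := hup false
  rw [mem_boundedChains_iff] at hG hG'
  refine ⟨fun m y => G m y - G' m y, fun m y => (hG.1 m y).sub (hG'.1 m y), fun m y => ?_,
    fun j => ?_⟩
  · refine (norm_sub_le _ _).trans ?_
    linarith [hG.2 m y, hG'.2 m y]
  · have h1 : G j 0 = e (Function.update x i true) j := congrFun hGj j
    have h2 : G' j 0 = e (Function.update x i false) j := congrFun hGj' j
    simp only [h1, h2, he]
    by_cases hji : j = i
    · subst hji; simp
    · simp [hji]

/-! ### Log-convex sequences -/

/-- The quotients `μ_1^{1/r}, …, μ_1^{1/r}, μ_2^{1/r}, …, μ_2^{1/r}, …`, each taken `r` times. -/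
noncomputable def ramQuot (r : ℕ) (M : ℕ → ℝ) (i : ℕ) : ℝ := quot M (i / r + 1) ^ (1 / (r : ℝ))

theorem IsLC.quot_pos {M : ℕ → ℝ} (hM : IsLC M) (p : ℕ) : 0 < quot M p := by
  rw [quot]
  split_ifs
  · exact one_pos
  · exact div_pos (hM.pos _) (hM.pos _)

theorem quot_succ (M : ℕ → ℝ) (p : ℕ) : quot M (p + 1) = M (p + 1) / M p := by
  simp [quot]

section

variable {M : ℕ → ℝ} {r : ℕ}

theorem IsLC.quot_mono (hM : IsLC M) : Monotone fun p => quot M (p + 1) := by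
  refine monotone_nat_of_le_succ fun p => ?_
  rw [quot_succ, quot_succ, div_le_div_iff₀ (hM.pos _) (hM.pos _), ← sq]
  have := hM.logConvex (p + 1) (by omega)
  rw [Nat.add_sub_cancel] at this
  linarith

theorem IsLC.weight_quot (hM : IsLC M) (n : ℕ) : weight (fun p => quot M (p + 1)) n = M n := by
  induction n with
  | zero => simp [weight, hM.zero_eq_one]
  | succ n ih =>
    rw [weight_succ, ih, quot_succ]
    have := (hM.pos n).ne'
    field_simp

theorem IsLC.ramQuot_pos (hM : IsLC M) (i : ℕ) : 0 < ramQuot r M i :=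
  Real.rpow_pos_of_pos (hM.quot_pos _) _

theorem IsLC.ramQuot_mono (hM : IsLC M) : Monotone (ramQuot r M) := fun i j hij =>
  Real.rpow_le_rpow (hM.quot_pos _).le (hM.quot_mono (Nat.div_le_div_right hij)) (by positivity)

theorem ramQuot_mul_add (M : ℕ → ℝ) {j : ℕ} (n : ℕ) (hj : j < r) :
    ramQuot r M (r * n + j) = quot M (n + 1) ^ (1 / (r : ℝ)) := by
  rw [ramQuot, Nat.mul_add_div (by omega), Nat.div_eq_of_lt hj, add_zero]

theorem IsLC.ramQuot_pow (hM : IsLC M) (hr : 1 ≤ r) (n : ℕ) :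
    ramQuot r M (r * n) ^ r = quot M (n + 1) := by
  have := ramQuot_mul_add M (j := 0) n (by omega : 0 < r)
  rw [add_zero] at this
  rw [this, one_div, Real.rpow_inv_natCast_pow (hM.quot_pos _).le (by omega)]

theorem weight_ramQuot_add (M : ℕ → ℝ) {j : ℕ} (n : ℕ) (hj : j ≤ r) :
    weight (ramQuot r M) (r * n + j) = weight (ramQuot r M) (r * n) * ramQuot r M (r * n) ^ j := by
  rcases Nat.eq_zero_or_pos r with rfl | hr
  · obtain rfl : j = 0 := by omega
    simp
  have h0 := ramQuot_mul_add M (j := 0) n hr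
  rw [add_zero] at h0
  have h1 : ∏ i ∈ Finset.range j, ramQuot r M (r * n + i) = ramQuot r M (r * n) ^ j := by
    rw [Finset.prod_congr (g := fun _ => ramQuot r M (r * n)) rfl
      fun i hi => by rw [ramQuot_mul_add M n (by have := Finset.mem_range.1 hi; omega), h0]]
    simp
  rw [weight, Finset.prod_range_add, h1, weight]

theorem IsLC.weight_ramQuot (hM : IsLC M) (hr : 1 ≤ r) (n : ℕ) :
    weight (ramQuot r M) (r * n) = M n := by
  induction n with
  | zero => simp [weight, hM.zero_eq_one]
  | succ n ih =>
    rw [mul_add, mul_one, weight_ramQuot_add M n le_rfl, ih, hM.ramQuot_pow hr, quot_succ]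
    have := (hM.pos n).ne'
    field_simp

theorem sum_range_mul_ramQuot (M : ℕ → ℝ) (m n : ℕ) :
    ∑ i ∈ Finset.range (r * n), (ramQuot r M (r * m + i))⁻¹ =
      r * ∑ k ∈ Finset.range n, (quot M (m + 1 + k) ^ (1 / (r : ℝ)))⁻¹ := by
  induction n with
  | zero => simp
  | succ n ih =>
    rw [mul_add, mul_one, Finset.sum_range_add, ih, Finset.sum_range_succ, mul_add]
    congr 1
    rw [Finset.sum_congr (g := fun _ => (quot M (m + 1 + n) ^ (1 / (r : ℝ)))⁻¹) rfl fun i hi => by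
      rw [← add_assoc, ← mul_add, ramQuot_mul_add M _ (Finset.mem_range.1 hi)]
      congr 3
      ring]
    simp

/-! ### The conditions in terms of partial sums -/

/-- Condition `(γ_r)` in terms of partial sums. -/
def GammaBound (r : ℝ) (M : ℕ → ℝ) : Prop :=
  ∃ C : ℝ, ∀ p : ℕ, 1 ≤ p → ∀ n,
    ∑ k ∈ Finset.range n, (quot M (p + k) ^ (1 / r))⁻¹ ≤ C * (p / quot M p ^ (1 / r))

theorem IsLC.iSup_mul_tail_lt_top_iff (hM : IsLC M) {r : ℝ} {c : ℕ → ℝ} (hc : ∀ p, 0 ≤ c p) :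
    (⨆ p : {p : ℕ // 1 ≤ p}, ENNReal.ofReal (c p) * tail r M p) < ⊤ ↔
      ∃ C : ℝ, ∀ p : ℕ, 1 ≤ p → ∀ n,
        c p * ∑ k ∈ Finset.range n, (quot M (p + k) ^ (1 / r))⁻¹ ≤ C := by
  have hinv : ∀ k, (1 / quot M k) ^ (1 / r) = (quot M k ^ (1 / r))⁻¹ := fun k => by
    rw [one_div (quot M k), Real.inv_rpow (hM.quot_pos k).le]
  have hpos : ∀ k, 0 ≤ (quot M k ^ (1 / r))⁻¹ := fun k =>
    inv_nonneg.2 (Real.rpow_nonneg (hM.quot_pos k).le _)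
  have hsum : ∀ p n, ∑ k ∈ Finset.range n, ENNReal.ofReal ((1 / quot M (p + k)) ^ (1 / r)) =
      ENNReal.ofReal (∑ k ∈ Finset.range n, (quot M (p + k) ^ (1 / r))⁻¹) := fun p n => by
    rw [ENNReal.ofReal_sum_of_nonneg fun k _ => hpos _]
    simp only [hinv]
  have htail : ∀ p, tail r M p =
      ⨆ n, ENNReal.ofReal (∑ k ∈ Finset.range n, (quot M (p + k) ^ (1 / r))⁻¹) := fun p => by
    rw [tail, ENNReal.tsum_eq_iSup_nat]
    simp only [hsum]
  constructor
  · intro h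
    refine ⟨_, fun p hp n => (ENNReal.ofReal_le_iff_le_toReal h.ne).1 ?_⟩
    refine le_trans ?_ (le_iSup _ (⟨p, hp⟩ : {p : ℕ // 1 ≤ p}))
    rw [ENNReal.ofReal_mul (hc p), htail]
    exact mul_le_mul_right (le_iSup (fun n => ENNReal.ofReal
      (∑ k ∈ Finset.range n, (quot M (p + k) ^ (1 / r))⁻¹)) n) _
  · rintro ⟨C, hC⟩
    refine lt_of_le_of_lt (iSup_le fun p => ?_) (ENNReal.ofReal_lt_top (r := C))
    rw [htail, ENNReal.mul_iSup]
    refine iSup_le fun n => ?_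
    rw [← ENNReal.ofReal_mul (hc p)]
    exact ENNReal.ofReal_le_ofReal (hC p p.2 n)

theorem IsLC.condGamma_iff (hM : IsLC M) {r : ℝ} : CondGamma r M M ↔ GammaBound r M := by
  rw [CondGamma, hM.iSup_mul_tail_lt_top_iff (c := fun p => quot M p ^ (1 / r) / (p : ℝ))
    fun p => div_nonneg (Real.rpow_nonneg (hM.quot_pos p).le _) (Nat.cast_nonneg p)]
  refine exists_congr fun C => forall₃_congr fun p hp n => ?_
  have h1 : 0 < quot M p ^ (1 / r) := Real.rpow_pos_of_pos (hM.quot_pos p) _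
  have h2 : (0 : ℝ) < p := by exact_mod_cast hp
  rw [← le_div_iff₀' (div_pos h1 h2), div_div_eq_mul_div, mul_div_assoc]

theorem IsLC.rpow_quot_mono (hM : IsLC M) {r : ℝ} (hr : 0 ≤ r) {p q : ℕ} (hp : 1 ≤ p)
    (hpq : p ≤ q) : quot M p ^ (1 / r) ≤ quot M q ^ (1 / r) := by
  obtain ⟨p, rfl⟩ := Nat.exists_eq_add_of_le' hp
  obtain ⟨q, rfl⟩ := Nat.exists_eq_add_of_le' (hp.trans hpq)
  exact Real.rpow_le_rpow (hM.quot_pos _).le (hM.quot_mono (by omega)) (by positivity)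

/-- The `a` skipped terms are each at most the first one. With `a = O(p)` this carries a tail
estimate from an index comparable to `p` back to `p`. -/
theorem IsLC.sum_le_add_sum (hM : IsLC M) {r : ℝ} (hr : 0 ≤ r) {p : ℕ} (hp : 1 ≤ p) (a n : ℕ) :
    ∑ k ∈ Finset.range n, (quot M (p + k) ^ (1 / r))⁻¹ ≤ a / quot M p ^ (1 / r) +
      ∑ k ∈ Finset.range n, (quot M (p + a + k) ^ (1 / r))⁻¹ := by
  have hpos : ∀ k, 0 < quot M k ^ (1 / r) := fun k => Real.rpow_pos_of_pos (hM.quot_pos k) _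
  calc _ ≤ ∑ k ∈ Finset.range (a + n), (quot M (p + k) ^ (1 / r))⁻¹ :=
        Finset.sum_le_sum_of_subset_of_nonneg (Finset.range_mono (by omega))
          fun k _ _ => (inv_pos.2 (hpos _)).le
    _ = ∑ k ∈ Finset.range a, (quot M (p + k) ^ (1 / r))⁻¹ +
        ∑ k ∈ Finset.range n, (quot M (p + a + k) ^ (1 / r))⁻¹ := by
      rw [Finset.sum_range_add]
      simp only [add_assoc]
    _ ≤ _ := by
      gcongr
      calc _ ≤ ∑ _k ∈ Finset.range a, (quot M p ^ (1 / r))⁻¹ := Finset.sum_le_sum fun k _ =>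
            inv_anti₀ (hpos p) (hM.rpow_quot_mono hr hp (by omega))
        _ = _ := by simp [div_eq_mul_inv]

/-- `M p / M j` is a product of `p - j` quotients, none exceeding `quot M p`. Hence `λ_{p,1} ≤ μ_p`.
-/
theorem IsLC.div_rpow_le_quot (hM : IsLC M) {p : ℕ} (j : Fin p) :
    (M p / ((1 : ℝ) ^ p * M j)) ^ (1 / ((p : ℝ) - ((j : ℕ) : ℝ))) ≤ quot M p := by
  obtain ⟨j, hj⟩ := j
  obtain ⟨i, rfl⟩ := Nat.exists_eq_add_of_lt hj
  have e : 1 / (((j + i + 1 : ℕ) : ℝ) - (j : ℝ)) = ((i + 1 : ℕ) : ℝ)⁻¹ := by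
    rw [one_div]; push_cast; congr 1; ring
  have hle : M (j + i + 1) / M j ≤ quot M (j + i + 1) ^ (i + 1) := by
    rw [div_le_iff₀ (hM.pos j), ← hM.weight_quot, ← hM.weight_quot j, add_assoc, weight, weight,
      Finset.prod_range_add, mul_comm]
    refine mul_le_mul_of_nonneg_right ?_ (Finset.prod_nonneg fun _ _ => (hM.quot_pos _).le)
    calc _ ≤ ∏ _x ∈ Finset.range (i + 1), quot M (j + (i + 1)) :=
          Finset.prod_le_prod (fun _ _ => (hM.quot_pos _).le) fun k hk =>
            hM.quot_mono (a := j + k) (b := j + i) (by have := Finset.mem_range.1 hk; omega)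
      _ = _ := by simp
  rw [one_pow, one_mul, e]
  calc _ ≤ (quot M (j + i + 1) ^ (i + 1)) ^ ((i + 1 : ℕ) : ℝ)⁻¹ :=
        Real.rpow_le_rpow (div_nonneg (hM.pos _).le (hM.pos _).le) hle (by positivity)
    _ = _ := Real.pow_rpow_inv_natCast (hM.quot_pos _).le (by omega)

/-- The entry `j = q` of the supremum suffices: `M (2q) / M q ≥ μ_q^q`, and the `q`-th root of
`s^{2q}` is `s²`. -/
theorem IsLC.quot_le_mul_lam (hM : IsLC M) {q s : ℕ} (hq : 1 ≤ q) (hs : 1 ≤ s) :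
    quot M q ≤ (s : ℝ) ^ 2 * lam M M (2 * q) s := by
  have hs0 : (0 : ℝ) < s := by exact_mod_cast hs
  have h1 := le_ciSup (f := fun j : Fin (2 * q) => (M (2 * q) / ((s : ℝ) ^ (2 * q) * M j)) ^
    (1 / (((2 * q : ℕ) : ℝ) - ((j : ℕ) : ℝ)))) (Set.finite_range _).bddAbove ⟨q, by omega⟩
  have e : 1 / (((2 * q : ℕ) : ℝ) - (q : ℝ)) = (q : ℝ)⁻¹ := by
    rw [one_div]; push_cast; congr 1; ring
  simp only [e] at h1
  have h2 : (quot M q / (s : ℝ) ^ 2) ^ q ≤ M (2 * q) / ((s : ℝ) ^ (2 * q) * M q) := by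
    have h3 := weight_mul_pow_le (fun i => hM.quot_pos (i + 1)) hM.quot_mono (n := 2 * q) (k := q)
      (by omega) (hM.quot_pos q).le (by
        obtain ⟨q, rfl⟩ := Nat.exists_eq_add_of_le' hq
        exact hM.quot_mono (by omega))
    rw [show 2 * q - q = q by omega, hM.weight_quot, hM.weight_quot] at h3
    have h4 := hM.pos q
    rw [div_pow, ← pow_mul, div_le_div_iff₀ (by positivity) (by positivity)]
    calc _ = (M q * quot M q ^ q) * (s : ℝ) ^ (2 * q) := by ring
      _ ≤ _ := by gcongr
  have h5 : quot M q / (s : ℝ) ^ 2 ≤ lam M M (2 * q) s := by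
    refine le_trans ?_ h1
    have h6 : 0 ≤ quot M q / (s : ℝ) ^ 2 := div_nonneg (hM.quot_pos q).le (by positivity)
    calc _ = ((quot M q / (s : ℝ) ^ 2) ^ q) ^ (q : ℝ)⁻¹ :=
          (Real.pow_rpow_inv_natCast h6 (by omega)).symm
      _ ≤ _ := Real.rpow_le_rpow (by positivity) h2 (by positivity)
  rwa [div_le_iff₀' (by positivity)] at h5

theorem IsLC.lam_nonneg (hM : IsLC M) (p s : ℕ) : 0 ≤ lam M M p s :=
  Real.iSup_nonneg fun j => Real.rpow_nonneg
    (div_nonneg (hM.pos _).le (mul_nonneg (by positivity) (hM.pos _).le)) _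

theorem IsLC.condSV_iff (hM : IsLC M) {r : ℝ} (hr : 0 ≤ r) : CondSV r M M ↔ GammaBound r M := by
  have hpos : ∀ k, 0 < quot M k ^ (1 / r) := fun k => Real.rpow_pos_of_pos (hM.quot_pos k) _
  have hiff := fun s : ℕ => hM.iSup_mul_tail_lt_top_iff (r := r)
    (c := fun p => lam M M p s ^ (1 / r) / (p : ℝ)) fun p =>
      div_nonneg (Real.rpow_nonneg (hM.lam_nonneg p s) _) (Nat.cast_nonneg p)
  constructor
  · rintro ⟨s, hs, h⟩
    obtain ⟨C, hC⟩ := (hiff s).1 h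
    set S : ℝ := ((s : ℝ) ^ 2) ^ (1 / r) with hS
    refine ⟨1 + S * (2 * C), fun q hq n => ?_⟩
    refine (hM.sum_le_add_sum hr hq q n).trans ?_
    have hq0 : (0 : ℝ) < q := by exact_mod_cast hq
    have h1 := hC (2 * q) (by omega) n
    have h2 : quot M q ^ (1 / r) ≤ S * lam M M (2 * q) s ^ (1 / r) := by
      rw [hS, ← Real.mul_rpow (by positivity) (hM.lam_nonneg _ _)]
      exact Real.rpow_le_rpow (hM.quot_pos q).le (hM.quot_le_mul_lam hq hs) (by positivity)
    have h0 := hpos q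
    rw [show q + q = 2 * q by ring, add_mul, one_mul]
    gcongr
    set Y := ∑ k ∈ Finset.range n, (quot M (2 * q + k) ^ (1 / r))⁻¹
    have h3 : 0 ≤ Y := Finset.sum_nonneg fun k _ => (inv_pos.2 (hpos _)).le
    rw [mul_div_assoc', le_div_iff₀ h0]
    calc Y * quot M q ^ (1 / r) ≤ Y * (S * lam M M (2 * q) s ^ (1 / r)) := by gcongr
      _ = S * (2 * (lam M M (2 * q) s ^ (1 / r) / ((2 * q : ℕ) : ℝ) * Y)) * q := by
        push_cast; field_simp
      _ ≤ S * (2 * C) * q := by gcongr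
  · rintro ⟨C, hC⟩
    refine ⟨1, le_rfl, (hiff 1).2 ⟨C, fun p hp n => ?_⟩⟩
    have hp0 : (0 : ℝ) < p := by exact_mod_cast hp
    have h1 : lam M M p 1 ≤ quot M p := by
      have : Nonempty (Fin p) := ⟨⟨0, hp⟩⟩
      exact ciSup_le fun j => by simpa only [Nat.cast_one] using hM.div_rpow_le_quot j
    have h2 : lam M M p 1 ^ (1 / r) ≤ quot M p ^ (1 / r) :=
      Real.rpow_le_rpow (hM.lam_nonneg _ _) h1 (by positivity)
    have h0 := hpos p
    have h3 := hC p hp n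
    have h4 : 0 ≤ ∑ k ∈ Finset.range n, (quot M (p + k) ^ (1 / r))⁻¹ :=
      Finset.sum_nonneg fun k _ => (inv_pos.2 (hpos _)).le
    calc _ ≤ quot M p ^ (1 / r) / p * ∑ k ∈ Finset.range n, (quot M (p + k) ^ (1 / r))⁻¹ := by
          gcongr
      _ ≤ quot M p ^ (1 / r) / p * (C * (p / quot M p ^ (1 / r))) := by gcongr
      _ = C := by field_simp

theorem IsLC.tailBound (hM : IsLC M) (hr : 1 ≤ r) (h : GammaBound r M) :
    ∃ C, TailBound (ramQuot r M) C := by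
  obtain ⟨C, hC⟩ := h
  have hpos : ∀ i, 0 < ramQuot r M i := fun i => hM.ramQuot_pos i
  have hC0 : 0 ≤ C := by
    have h1 := hC 1 le_rfl 0
    have h2 : 0 < quot M 1 ^ (1 / (r : ℝ)) := Real.rpow_pos_of_pos (hM.quot_pos 1) _
    rw [Finset.range_zero, Finset.sum_empty] at h1
    exact nonneg_of_mul_nonneg_left h1 (by positivity)
  have hpart : ∀ p n, ∑ i ∈ Finset.range n, (ramQuot r M (p + i))⁻¹ ≤
      r * C * ((p + 1) / ramQuot r M p) := by
    intro p n
    have hm := Nat.div_add_mod p r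
    have hlt := Nat.mod_lt p (by omega : 0 < r)
    set m := p / r with hmdef
    set c := p % r
    have hτp : ramQuot r M p = quot M (m + 1) ^ (1 / (r : ℝ)) := rfl
    have hmp : m ≤ p := Nat.div_le_self _ _
    calc _ ≤ ∑ i ∈ Finset.range (c + n), (ramQuot r M (r * m + i))⁻¹ := by
          rw [Finset.sum_range_add]
          simp only [← add_assoc, hm]
          exact le_add_of_nonneg_left (Finset.sum_nonneg fun i _ => (inv_pos.2 (hpos _)).le)
      _ ≤ ∑ i ∈ Finset.range (r * (1 + n)), (ramQuot r M (r * m + i))⁻¹ :=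
          Finset.sum_le_sum_of_subset_of_nonneg (Finset.range_mono (by nlinarith))
            fun i _ _ => (inv_pos.2 (hpos _)).le
      _ = r * ∑ k ∈ Finset.range (1 + n), (quot M (m + 1 + k) ^ (1 / (r : ℝ)))⁻¹ :=
          sum_range_mul_ramQuot M m _
      _ ≤ r * (C * (((m + 1 : ℕ) : ℝ) / quot M (m + 1) ^ (1 / (r : ℝ)))) := by
          gcongr
          exact hC (m + 1) (Nat.succ_le_succ (Nat.zero_le _)) _
      _ ≤ r * (C * ((p + 1) / ramQuot r M p)) := by
          have := hpos p
          rw [← hτp]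
          gcongr
          exact_mod_cast Nat.succ_le_succ hmp
      _ = _ := by ring
  refine ⟨r * C, hpos, hM.ramQuot_mono, ?_, fun p => ?_⟩
  · refine summable_of_sum_range_le (c := r * C * (((0 : ℕ) + 1) / ramQuot r M 0))
      (fun i => (inv_pos.2 (hpos i)).le) fun n => ?_
    simpa only [zero_add] using hpart 0 n
  · exact Real.tsum_le_of_sum_range_le (fun i => (inv_pos.2 (hpos _)).le) (hpart p)

end

section

variable {M : ℕ → ℝ} {r : ℕ}

/-! ### Sufficiency of the condition -/

theorem exists_norm_le_of_mem_seqSpace {h : ℝ} (hM : IsLC M) (hh : 0 < h) {a : ℕ → ℂ}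
    (ha : a ∈ seqSpace M h) : ∃ B, 0 ≤ B ∧ ∀ n, ‖a n‖ ≤ B * (h ^ n * M n) := by
  obtain ⟨B, hB⟩ := ha
  have hle : ∀ n, ‖a n‖ / (h ^ n * M n) ≤ B := fun n => hB ⟨n, rfl⟩
  have hpos : ∀ n, 0 < h ^ n * M n := fun n => mul_pos (pow_pos hh n) (hM.pos n)
  exact ⟨B, (div_nonneg (norm_nonneg _) (hpos 0).le).trans (hle 0),
    fun n => (div_le_iff₀ (hpos n)).1 (hle n)⟩

/-- The sequence with the entries of `a` at the multiples of `r` and zeros elsewhere. -/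
def spread (r : ℕ) (a : ℕ → ℂ) (i : ℕ) : ℂ := if r ∣ i then a (i / r) else 0

theorem spread_mul (hr : 1 ≤ r) (a : ℕ → ℂ) (n : ℕ) : spread r a (r * n) = a n := by
  rw [spread, if_pos (dvd_mul_right _ _), Nat.mul_div_cancel_left _ (by omega)]

theorem spread_mul_add (a : ℕ → ℂ) (n : ℕ) {j : ℕ} (hj : 1 ≤ j) (hjr : j < r) :
    spread r a (r * n + j) = 0 := by
  rw [spread, if_neg]
  intro h
  have := Nat.le_of_dvd hj ((Nat.dvd_add_right (dvd_mul_right r n)).1 h)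
  omega

theorem IsLC.norm_spread_le (hM : IsLC M) (hr : 1 ≤ r) {a : ℕ → ℂ} {H B : ℝ} (hH : 0 < H)
    (hB : 0 ≤ B) (ha : ∀ n, ‖a n‖ ≤ B * ((H ^ r) ^ n * M n)) (i : ℕ) :
    ‖spread r a i‖ ≤ B * (H ^ i * weight (ramQuot r M) i) := by
  by_cases h : r ∣ i
  · obtain ⟨n, rfl⟩ := h
    rw [spread_mul hr, hM.weight_ramQuot hr, pow_mul]
    exact ha n
  · have := weight_pos (fun i => hM.ramQuot_pos (r := r) i) i
    rw [spread, if_neg h, norm_zero]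
    positivity

theorem IsLC.memTest_of_spread (hM : IsLC M) (hr : 1 ≤ r) {a : ℕ → ℂ} {f : ℝ → ℂ} {δ h B : ℝ}
    (hδ : 0 < δ) (hδh : δ ^ r ≤ h) (hf : ContDiff ℝ ∞ f) (hsupp : tsupport f ⊆ Set.Icc (-1) 1)
    (hjet : ∀ n, iteratedDeriv n f 0 = spread r a n)
    (hB : ∀ n x, ‖iteratedDeriv n f x‖ ≤ B * (δ ^ n * weight (ramQuot r M) n)) :
    MemTest r M h 1 f := by
  have hh : 0 < h := (pow_pos hδ r).trans_le hδh
  refine ⟨hf, hsupp, fun n j hj hjr => ?_, B, ?_⟩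
  · rw [hjet, spread_mul_add a n hj hjr]
  · rintro _ ⟨⟨n, x⟩, rfl⟩
    have hMn := hM.pos n
    have hB0 : 0 ≤ B := by
      have h1 := (norm_nonneg _).trans (hB 0 0)
      simpa [weight] using h1
    rw [div_le_iff₀ (by positivity)]
    refine (hB _ x).trans ?_
    rw [hM.weight_ramQuot hr, pow_mul]
    gcongr

theorem IsLC.surjective_borelRoumieu (hM : IsLC M) (hr : 1 ≤ r) (h : GammaBound r M) :
    Function.Surjective (borelRoumieu r M) := by
  obtain ⟨C, hC⟩ := hM.tailBound hr h
  rintro ⟨a, h, hh, ha⟩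
  obtain ⟨B, hB, haB⟩ := exists_norm_le_of_mem_seqSpace hM hh ha
  have hle : h ≤ (max 1 h) ^ r :=
    (le_max_right 1 h).trans (le_self_pow₀ (le_max_left 1 h) (by omega))
  obtain ⟨f, hf, hs, hj, T, hT, B', hB'⟩ := hC.exists_roumieu (b := spread r a)
    (by positivity : 0 < max 1 h) (hM.norm_spread_le hr (by positivity) hB fun n =>
      (haB n).trans (by have := hM.pos n; gcongr))
  exact ⟨⟨f, T ^ r, pow_pos hT r, hM.memTest_of_spread hr hT le_rfl hf hs hj hB'⟩,
    Subtype.ext (funext fun n => (hj _).trans (spread_mul hr a n))⟩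

theorem IsLC.surjective_borelBeurling (hM : IsLC M) (hr : 1 ≤ r) (h : GammaBound r M) :
    Function.Surjective (borelBeurling r M) := by
  obtain ⟨C, hC⟩ := hM.tailBound hr h
  rintro ⟨a, ha⟩
  obtain ⟨f, hf, hs, hj, hB⟩ := hC.exists_beurling (b := spread r a) fun δ hδ => by
    obtain ⟨B, hB, haB⟩ := exists_norm_le_of_mem_seqSpace hM (pow_pos hδ r) (ha _ (pow_pos hδ r))
    exact ⟨B, hM.norm_spread_le hr hδ hB haB⟩
  refine ⟨⟨f, fun h hh => ?_⟩, Subtype.ext (funext fun n => (hj _).trans (spread_mul hr a n))⟩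
  have hδ : 0 < min 1 h := lt_min one_pos hh
  obtain ⟨B, hB⟩ := hB _ hδ
  exact hM.memTest_of_spread hr hδ ((pow_le_of_le_one hδ.le (min_le_left _ _) (by omega)).trans
    (min_le_right _ _)) hf hs hj hB

/-! ### Necessity of the condition -/

/-- Interpolation between the orders `r n` and `r (n + 1)` with scale `s = μ_{n+1}^{1/r}`, for which
`M n * s ^ r = M (n + 1)`. Compact support makes all the suprema finite. -/
theorem MemTest.exists_norm_iteratedDeriv_le (hM : IsLC M) (hr : 1 ≤ r) {h a : ℝ} (hh : 0 < h)
    {f : ℝ → ℂ} (hf : MemTest r M h a f) :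
    ∃ B, 0 ≤ B ∧ ∀ m x, ‖iteratedDeriv m f x‖ ≤
      B * ((max 1 h) ^ m * weight (ramQuot r M) m) := by
  obtain ⟨A, hA⟩ := hf.bound
  have hpos : ∀ n, 0 < h ^ n * M n := fun n => mul_pos (pow_pos hh n) (hM.pos n)
  have hA' : ∀ n x, ‖iteratedDeriv (r * n) f x‖ ≤ A * (h ^ n * M n) := fun n x =>
    (div_le_iff₀ (hpos n)).1 (hA ⟨(n, x), rfl⟩)
  have hA0 : 0 ≤ A := by
    have h1 := (norm_nonneg _).trans (hA' 0 0)
    simpa [hM.zero_eq_one] using h1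
  have hchain := isDerivChain_iteratedDeriv hf.smooth
  have hcs : HasCompactSupport f := HasCompactSupport.of_support_subset_isCompact isCompact_Icc
    ((subset_tsupport f).trans hf.supp)
  have hbdd : ∀ m, ∃ B, ∀ x, ‖iteratedDeriv m f x‖ ≤ B := fun m => by
    have h1 : HasCompactSupport fun x => iteratedFDeriv ℝ m f x := hcs.iteratedFDeriv m
    have h2 : Continuous fun x => iteratedFDeriv ℝ m f x :=
      hf.smooth.continuous_iteratedFDeriv (mod_cast le_top)
    obtain ⟨B, hB⟩ := h1.exists_bound_of_continuous h2
    exact ⟨B, fun x => by rw [← norm_iteratedFDeriv_eq_norm_iteratedDeriv]; exact hB x⟩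
  set H := max 1 h with hH
  have hH1 : 1 ≤ H := le_max_left _ _
  refine ⟨3 ^ r ^ 2 * (A * H), by positivity, fun m x => ?_⟩
  have hm := Nat.div_add_mod m r
  have hlt := Nat.mod_lt m (by omega : 0 < r)
  have hnm : m / r ≤ m := Nat.div_le_self _ _
  generalize m / r = n at hm hnm
  generalize m % r = j at hm hlt
  have hMn := hM.pos n
  have hMn1 := hM.pos (n + 1)
  have hτ := hM.ramQuot_pos (r := r) (r * n)
  have hsub : IsDerivChain fun k => iteratedDeriv (r * n + k) f := fun k x => hchain (r * n + k) x
  have h1 := hsub.norm_le_of_norm_le (fun k => hbdd _) hlt.le (B := A * (H ^ (n + 1) * M n)) hτ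
    (fun x => (hA' n x).trans (by
      have h2 : h ^ n ≤ H ^ (n + 1) :=
        (pow_le_pow_left₀ hh.le (le_max_right _ _) n).trans (pow_le_pow_right₀ hH1 (by omega))
      gcongr))
    (fun x => by
      rw [← mul_add_one]
      refine (hA' (n + 1) x).trans ?_
      rw [hM.ramQuot_pow hr, quot_succ]
      have h2 : h ^ (n + 1) ≤ H ^ (n + 1) := pow_le_pow_left₀ hh.le (le_max_right _ _) _
      calc _ ≤ A * (H ^ (n + 1) * M (n + 1)) := by gcongr
        _ = _ := by field_simp) x
  rw [← hm]
  refine h1.trans ?_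
  rw [weight_ramQuot_add M n hlt.le, hM.weight_ramQuot hr, hm]
  calc _ = 3 ^ r ^ 2 * (A * H) * (H ^ n * (M n * ramQuot r M (r * n) ^ j)) := by ring
    _ ≤ _ := by gcongr

/-- `IsDerivChain.sum_inv_le` is applied at `Q = r (q + k)`, so that small `q` are covered too. It
controls the tail from an index `O(q)`, and the skipped terms contribute `O(q / μ_q^{1/r})`. -/
theorem IsLC.gammaBound_of_chains (hM : IsLC M) (hr : 1 ≤ r) {H L : ℝ} (hH : 1 ≤ H) (hL : 1 ≤ L)
    {k : ℕ} (h : ∀ q ≥ k, 1 ≤ q → ∃ G, IsDerivChain G ∧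
      (∀ m, G m 0 = if m = 2 * (r * q) then 1 else 0) ∧
      ∀ m x, ‖G m x‖ ≤ L ^ (r * q) * H ^ m *
        (weight (ramQuot r M) m / weight (ramQuot r M) (2 * (r * q)))) :
    GammaBound r M := by
  obtain ⟨N, hN⟩ := exists_nat_ge (2 * H * L + 1)
  set c := Real.exp 1 * H * (2 * H * L) with hc
  have hc0 : 0 ≤ c := by positivity
  refine ⟨(N + 1) * (k + 1) + 1 + c * (k + 1), fun q hq n => ?_⟩
  set q' := q + k with hq'
  obtain ⟨G, hG, hj, hb⟩ := h q' (by omega) (by omega)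
  have h1 := hG.sum_inv_le (fun i => hM.ramQuot_pos i) hM.ramQuot_mono hH hL
    (Q := r * q') (N := N) (Nat.mul_pos (by omega) (by omega)) hN hj hb (r * n)
  rw [show (N + 1) * (r * q') = r * ((N + 1) * q') by ring, sum_range_mul_ramQuot] at h1
  have hr0 : (0 : ℝ) < r := by exact_mod_cast hr
  have h0 := ramQuot_mul_add M (j := 0) q' (by omega : 0 < r)
  rw [add_zero] at h0
  have h2 : ∑ i ∈ Finset.range n, (quot M ((N + 1) * q' + 1 + i) ^ (1 / (r : ℝ)))⁻¹ ≤
      c * (q' / quot M (q' + 1) ^ (1 / (r : ℝ))) := by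
    refine le_of_mul_le_mul_left (h1.trans (le_of_eq ?_)) hr0
    rw [h0]
    push_cast
    ring
  have hle : q ≤ (N + 1) * q' := by nlinarith
  have h3 := hM.sum_le_add_sum hr0.le hq ((N + 1) * q' + 1 - q) n
  rw [show q + ((N + 1) * q' + 1 - q) = (N + 1) * q' + 1 by omega] at h3
  have hpos : 0 < quot M q ^ (1 / (r : ℝ)) := Real.rpow_pos_of_pos (hM.quot_pos q) _
  have hmono := hM.rpow_quot_mono hr0.le hq (by omega : q ≤ q' + 1)
  have hq1 : (1 : ℝ) ≤ q := by exact_mod_cast hq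
  have hq'q : (q' : ℝ) ≤ (k + 1) * q := by
    rw [hq']
    push_cast
    nlinarith [(Nat.cast_nonneg k : (0 : ℝ) ≤ k)]
  have h4 : (((N + 1) * q' + 1 - q : ℕ) : ℝ) ≤ ((N + 1) * (k + 1) + 1) * q := by
    calc (((N + 1) * q' + 1 - q : ℕ) : ℝ) ≤ (((N + 1) * q' + 1 : ℕ) : ℝ) := by
          exact_mod_cast Nat.sub_le _ _
      _ = (N + 1) * q' + 1 := by push_cast; ring
      _ ≤ (N + 1) * ((k + 1) * q) + q := by gcongr
      _ = _ := by ring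
  calc _ ≤ _ := h3
    _ ≤ (((N + 1) * (k + 1) + 1) * q) / quot M q ^ (1 / (r : ℝ)) +
        c * (((k + 1) * q) / quot M q ^ (1 / (r : ℝ))) := by
      gcongr
      refine h2.trans ?_
      gcongr
    _ = _ := by ring

/-- If all the sequences with entries in `{0, v n}` are `r`-ramified jets, then those with a single
nonzero entry are jets with uniform bounds. -/
theorem IsLC.exists_uniform_bound_spread (hM : IsLC M) (hr : 1 ≤ r) {v : ℕ → ℝ} {h : ℕ → ℝ}
    (hv : ∀ x : ℕ → Bool, ∃ (f : ℝ → ℂ) (h₀ : ℝ), 0 < h₀ ∧ (∀ᶠ n in atTop, h₀ ≤ h n) ∧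
      MemTest r M h₀ 1 f ∧ ∀ n, jet r f n = if x n then (v n : ℂ) else 0) :
    ∃ n k : ℕ, ∀ p ≥ k, ∃ G, IsDerivChain G ∧
      (∀ m y, ‖G m y‖ ≤ 2 * (n * ((max 1 (h n)) ^ m * weight (ramQuot r M) m))) ∧
      ∀ j, G j 0 = if j = r * p then (v p : ℂ) else 0 := by
  obtain ⟨n, k, hnk⟩ := exists_uniform_bound (v := spread r fun n => (v n : ℂ))
    (B := fun n m => n * ((max 1 (h n)) ^ m * weight (ramQuot r M) m)) fun x => by
      obtain ⟨f, h₀, hh₀, hn, hf, hj⟩ := hv fun n => x (r * n)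
      obtain ⟨B, hB, hfB⟩ := hf.exists_norm_iteratedDeriv_le hM hr hh₀
      -- A single integer `n` dominates both the constant and the rate, so countably many bounds
      -- cover all cases, as Baire's theorem requires.
      obtain ⟨n, hn, hBn⟩ := (hn.and
        (tendsto_natCast_atTop_atTop.eventually_ge_atTop B)).exists
      refine ⟨n, _, isDerivChain_iteratedDeriv hf.smooth, fun m y => (hfB m y).trans ?_,
        fun i => ?_⟩
      · have := weight_pos (fun i => hM.ramQuot_pos (r := r) i) m
        gcongr
      · show iteratedDeriv i f 0 = _
        have hi := Nat.div_add_mod i r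
        have hlt := Nat.mod_lt i (by omega : 0 < r)
        rw [← hi]
        rcases Nat.eq_zero_or_pos (i % r) with h0 | h0
        · rw [h0, add_zero, spread_mul hr]
          exact hj (i / r)
        · rw [spread_mul_add _ _ h0 hlt, ite_self]
          exact hf.vanish _ _ h0 hlt
  refine ⟨n, k, fun p hp => ?_⟩
  obtain ⟨G, hG, hb, hj⟩ := hnk (r * p) (hp.le.trans (Nat.le_mul_of_pos_left p (by omega)))
  rw [spread_mul hr] at hj
  exact ⟨G, hG, hb, hj⟩

theorem IsDerivChain.const_mul {G : ℕ → ℝ → ℂ} (hG : IsDerivChain G) (c : ℂ) :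
    IsDerivChain fun m x => c * G m x := fun m x => (hG m x).const_mul c

theorem IsLC.gammaBound_of_surjective_borelRoumieu (hM : IsLC M) (hr : 1 ≤ r)
    (h : Function.Surjective (borelRoumieu r M)) : GammaBound r M := by
  obtain ⟨n, k, hnk⟩ := hM.exists_uniform_bound_spread hr (v := M) (h := fun n => n) fun x => by
    have ha : (fun n => if x n then (M n : ℂ) else 0) ∈ seqRoumieu M := by
      refine ⟨1, one_pos, 1, ?_⟩
      rintro _ ⟨p, rfl⟩
      have hMp := hM.pos p
      simp only [one_pow, one_mul]
      rw [div_le_one hMp]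
      split_ifs
      · rw [Complex.norm_real, Real.norm_eq_abs, abs_of_pos hMp]
      · rw [norm_zero]; exact hMp.le
    obtain ⟨⟨f, h₀, hh₀, hf⟩, hfa⟩ := h ⟨_, ha⟩
    exact ⟨f, h₀, hh₀, tendsto_natCast_atTop_atTop.eventually_ge_atTop h₀, hf,
      fun n => congrFun (congrArg Subtype.val hfa) n⟩
  refine hM.gammaBound_of_chains hr (le_max_left 1 (n : ℝ)) (le_max_left 1 (2 * n : ℝ)) (k := k)
    fun q hq hq1 => ?_
  obtain ⟨G, hG, hb, hj⟩ := hnk (2 * q) (by omega)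
  have hW : weight (ramQuot r M) (2 * (r * q)) = M (2 * q) := by
    rw [← hM.weight_ramQuot hr]
    congr 1
    ring
  have hMq := hM.pos (2 * q)
  have hMq' : (M (2 * q) : ℂ) ≠ 0 := Complex.ofReal_ne_zero.2 hMq.ne'
  refine ⟨_, hG.const_mul (M (2 * q) : ℂ)⁻¹, fun m => ?_, fun m x => ?_⟩
  · rw [hj, show r * (2 * q) = 2 * (r * q) by ring]
    split_ifs
    · exact inv_mul_cancel₀ hMq'
    · exact mul_zero _
  · have hWm := weight_pos (fun i => hM.ramQuot_pos (r := r) i) m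
    rw [norm_mul, norm_inv, Complex.norm_real, Real.norm_eq_abs, abs_of_pos hMq, hW]
    have h1 : (2 * n : ℝ) ≤ (max 1 (2 * n : ℝ)) ^ (r * q) :=
      (le_max_right _ _).trans (le_self_pow₀ (le_max_left _ _)
        (Nat.mul_pos (by omega) (by omega)).ne')
    calc _ ≤ (M (2 * q))⁻¹ * (2 * (n * ((max 1 (n : ℝ)) ^ m * weight (ramQuot r M) m))) := by
          gcongr
          exact hb m x
      _ = (2 * n : ℝ) * (max 1 (n : ℝ)) ^ m * (weight (ramQuot r M) m / M (2 * q)) := by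
          field_simp
      _ ≤ _ := by gcongr

/-! ### Unit jets from Beurling surjectivity -/

/-- The existence of a smooth function with jet `δ_p` and derivatives bounded with a factor
`s ^ p`. -/
def HasUnitJet (r : ℕ) (M : ℕ → ℝ) (s : ℝ) (p : ℕ) : Prop :=
  ∃ G, IsDerivChain G ∧ (∀ m, G m 0 = if m = r * p then 1 else 0) ∧
    ∀ m x, ‖G m x‖ ≤ s ^ p * (weight (ramQuot r M) m / M p)

/-- The sequence `M` is not itself in the Beurling space, but after division by `g p ^ p` every
choice of its entries is. Normalising the jet brings the factor `g p ^ p` back. -/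
theorem IsLC.exists_hasUnitJet (hM : IsLC M) (hr : 1 ≤ r)
    (h : Function.Surjective (borelBeurling r M)) {g : ℕ → ℝ} (hg : ∀ p, 0 < g p)
    (hlim : Tendsto g atTop atTop) : ∃ n k : ℕ, ∀ p ≥ k, HasUnitJet r M (n * g p) p := by
  obtain ⟨n, k, hnk⟩ := hM.exists_uniform_bound_spread hr (v := fun p => M p / g p ^ p)
    (h := fun _ => 1) fun x => by
    have ha : (fun n => if x n then ((M n / g n ^ n : ℝ) : ℂ) else 0) ∈ seqBeurling M := by
      intro δ hδ
      obtain ⟨N, hN⟩ := eventually_atTop.1 (hlim.eventually_ge_atTop δ⁻¹)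
      have hle : ∀ p, ‖if x p then ((M p / g p ^ p : ℝ) : ℂ) else 0‖ / (δ ^ p * M p) ≤
          ((δ * g p) ^ p)⁻¹ := by
        intro p
        have hMp := hM.pos p
        have hgp := hg p
        split_ifs
        · rw [Complex.norm_real, Real.norm_eq_abs, abs_of_pos (by positivity), mul_pow]
          refine le_of_eq ?_
          field_simp
        · rw [norm_zero, zero_div]; positivity
      refine (isBoundedUnder_of_eventually_le (a := 1) ?_).bddAbove_range
      filter_upwards [eventually_ge_atTop N] with p hp
      refine (hle p).trans (inv_le_one_of_one_le₀ (one_le_pow₀ ?_))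
      have h2 := mul_le_mul_of_nonneg_left (hN p hp) hδ.le
      rwa [mul_inv_cancel₀ hδ.ne'] at h2
    obtain ⟨⟨f, hf⟩, hfa⟩ := h ⟨_, ha⟩
    exact ⟨f, 1, one_pos, Eventually.of_forall fun _ => le_rfl, hf 1 one_pos,
      fun n => congrFun (congrArg Subtype.val hfa) n⟩
  refine ⟨2 * n + 1, k + 1, fun p hp => ?_⟩
  obtain ⟨G, hG, hb, hj⟩ := hnk p (by omega)
  have hMp := hM.pos p
  have hgp := hg p
  have hv : (0 : ℝ) < M p / g p ^ p := by positivity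
  refine ⟨_, hG.const_mul ((M p / g p ^ p : ℝ) : ℂ)⁻¹, fun m => ?_, fun m x => ?_⟩
  · rw [hj]
    split_ifs
    · exact inv_mul_cancel₀ (Complex.ofReal_ne_zero.2 hv.ne')
    · exact mul_zero _
  · have hWm := weight_pos (fun i => hM.ramQuot_pos (r := r) i) m
    rw [norm_mul, norm_inv, Complex.norm_real, Real.norm_eq_abs, abs_of_pos hv]
    have h1 : (2 * n : ℝ) ≤ ((2 * n + 1 : ℕ) : ℝ) ^ p := by
      push_cast
      calc (2 * n : ℝ) ≤ 2 * n + 1 := by linarith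
        _ ≤ _ := le_self_pow₀ (by linarith [(Nat.cast_nonneg n : (0 : ℝ) ≤ n)]) (by omega)
    calc _ ≤ (M p / g p ^ p)⁻¹ * (2 * (n * ((max 1 (1 : ℝ)) ^ m * weight (ramQuot r M) m))) := by
          gcongr
          exact hb m x
      _ = (2 * n : ℝ) * g p ^ p * (weight (ramQuot r M) m / M p) := by
          rw [max_self, one_pow]
          field_simp
      _ ≤ ((2 * n + 1 : ℕ) : ℝ) ^ p * g p ^ p * (weight (ramQuot r M) m / M p) := by gcongr
      _ = _ := by rw [mul_pow]

theorem HasUnitJet.mono (hM : IsLC M) {s t : ℝ} (hs : 0 ≤ s) (hst : s ≤ t) {p : ℕ}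
    (h : HasUnitJet r M s p) : HasUnitJet r M t p := by
  obtain ⟨G, hG, hj, hb⟩ := h
  refine ⟨G, hG, hj, fun m x => (hb m x).trans ?_⟩
  have hWm := weight_pos (fun i => hM.ramQuot_pos (r := r) i) m
  have hMp := hM.pos p
  gcongr

/-- A function tending to infinity which grows slowly along a given sequence of indices. -/
theorem exists_tendsto_atTop_comp_le {ψ : ℕ → ℕ} (hψ : StrictMono ψ) :
    ∃ c : ℕ → ℕ, Tendsto c atTop atTop ∧ ∀ i, c (ψ i) ≤ i + 1 := by
  refine ⟨fun p => ((Finset.range (p + 1)).filter fun i => ψ i ≤ p).card, ?_, fun i => ?_⟩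
  · refine tendsto_atTop.2 fun b => eventually_atTop.2 ⟨ψ b, fun p hp => ?_⟩
    calc b = (Finset.range b).card := (Finset.card_range b).symm
      _ ≤ _ := Finset.card_le_card fun i hi => by
        have hib := Finset.mem_range.1 hi
        have h1 : ψ i ≤ p := (hψ.monotone hib.le).trans hp
        exact Finset.mem_filter.2 ⟨Finset.mem_range.2 (by have := hψ.id_le i; simp at this; omega), h1⟩
  · calc _ ≤ (Finset.range (i + 1)).card := Finset.card_le_card fun j hj => by
          have h1 := hψ.le_iff_le.1 (Finset.mem_filter.1 hj).2
          exact Finset.mem_range.2 (by omega)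
      _ = i + 1 := Finset.card_range _

theorem IsLC.gammaBound_of_surjective_borelBeurling (hM : IsLC M) (hr : 1 ≤ r)
    (h : Function.Surjective (borelBeurling r M)) : GammaBound r M := by
  have hex : ∃ s : ℕ, ∀ᶠ p in atTop, HasUnitJet r M s p := by
    -- If every `s` failed infinitely often, there would be indices `ψ i` at which `s = i` fails; a
    -- `g → ∞` of size at most `√(i + 2)` at `ψ i` then contradicts `exists_hasUnitJet`.
    by_contra! hcon
    obtain ⟨ψ, hψ, hψn⟩ := extraction_forall_of_frequently hcon
    obtain ⟨c, hc, hcψ⟩ := exists_tendsto_atTop_comp_le hψ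
    obtain ⟨n, k, hnk⟩ := hM.exists_hasUnitJet hr h (g := fun p => √((c p : ℝ) + 1))
      (fun p => by positivity) (Real.tendsto_sqrt_atTop.comp
        (tendsto_atTop_add_const_right _ _ (tendsto_natCast_atTop_atTop.comp hc)))
    -- Large enough that `n² (i + 2) ≤ 3 n² i ≤ i²`, that is `n √(i + 2) ≤ i`, and that `ψ i ≥ k`.
    set i := 3 * n ^ 2 + k + 1 with hi
    refine hψn i ((hnk (ψ i) ((by omega : k ≤ i).trans (hψ.id_le i))).mono hM (by positivity) ?_)
    have h1 : (c (ψ i) : ℝ) + 1 ≤ i + 2 := by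
      have : (c (ψ i) : ℝ) ≤ ((i + 1 : ℕ) : ℝ) := by exact_mod_cast hcψ i
      push_cast at this
      linarith
    have h2 : (n : ℝ) ^ 2 * (i + 2) ≤ (i : ℝ) ^ 2 := by
      have h3 : n ^ 2 * (i + 2) ≤ i ^ 2 := by
        have h4 : 3 * n ^ 2 ≤ i := by omega
        have h5 : 1 ≤ i := by omega
        nlinarith
      exact_mod_cast h3
    refine abs_le_of_sq_le_sq' ?_ (by positivity) |>.2
    rw [mul_pow, Real.sq_sqrt (by positivity)]
    refine le_trans ?_ h2
    gcongr
  obtain ⟨s, hs⟩ := hex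
  obtain ⟨k, hk⟩ := eventually_atTop.1 hs
  have hs1 : (1 : ℝ) ≤ max 1 (s : ℝ) := le_max_left _ _
  refine hM.gammaBound_of_chains hr le_rfl (one_le_pow₀ hs1 (n := 2)) (k := k) fun q hq hq1 => ?_
  obtain ⟨G, hG, hj, hb⟩ := hk (2 * q) (by omega)
  refine ⟨G, hG, fun m => ?_, fun m x => ?_⟩
  · rw [hj, show r * (2 * q) = 2 * (r * q) by ring]
  · have hW : weight (ramQuot r M) (2 * (r * q)) = M (2 * q) := by
      rw [← hM.weight_ramQuot hr]
      congr 1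
      ring
    have hWm := weight_pos (fun i => hM.ramQuot_pos (r := r) i) m
    have hMp := hM.pos (2 * q)
    rw [hW, one_pow, mul_one, ← pow_mul]
    refine (hb m x).trans ?_
    gcongr ?_ * _
    calc (s : ℝ) ^ (2 * q) ≤ max 1 (s : ℝ) ^ (2 * q) := by
          gcongr
          exact le_max_right _ _
      _ ≤ _ := pow_le_pow_right₀ hs1 (by nlinarith)

end

end RamifiedBorel

theorem mainTheorem4 (M : ℕ → ℝ) (hM : RamifiedBorel.IsLC M) (r : ℕ) (hr : 1 ≤ r) :
    (RamifiedBorel.CondB r M →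
      List.TFAE
        [Function.Surjective (RamifiedBorel.borelRoumieu r M),
         Function.Surjective (RamifiedBorel.borelBeurling r M),
         RamifiedBorel.CondSV r M M,
         RamifiedBorel.CondGamma r M M]) ∧
    (RamifiedBorel.CondR r M →
      List.TFAE
        [Function.Surjective (RamifiedBorel.borelRoumieu r M),
         RamifiedBorel.CondSV r M M,
         RamifiedBorel.CondGamma r M M]) := by
  have h1 : Function.Surjective (RamifiedBorel.borelRoumieu r M) ↔ RamifiedBorel.CondGamma r M M :=
    ⟨fun h => hM.condGamma_iff.2 (hM.gammaBound_of_surjective_borelRoumieu hr h),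
      fun h => hM.surjective_borelRoumieu hr (hM.condGamma_iff.1 h)⟩
  have h2 : Function.Surjective (RamifiedBorel.borelBeurling r M) ↔ RamifiedBorel.CondGamma r M M :=
    ⟨fun h => hM.condGamma_iff.2 (hM.gammaBound_of_surjective_borelBeurling hr h),
      fun h => hM.surjective_borelBeurling hr (hM.condGamma_iff.1 h)⟩
  have h3 : RamifiedBorel.CondSV r M M ↔ RamifiedBorel.CondGamma r M M :=
    (hM.condSV_iff (Nat.cast_nonneg r)).trans hM.condGamma_iff.symm
  refine ⟨fun _ => ?_, fun _ => ?_⟩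
  · tfae_have 1 ↔ 4 := h1
    tfae_have 2 ↔ 4 := h2
    tfae_have 3 ↔ 4 := h3
    tfae_finish
  · tfae_have 1 ↔ 3 := h1
    tfae_have 2 ↔ 3 := h3
    tfae_finish
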